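/- A family $\mathcal H$ of partial functions from $\omega$ to $\omega$ is *coherent* if $\{n\in\mathrm{dom}(f)\cap\mathrm{dom}(g): f(n)\neq g(n)\}$ is finite for all $f,g\in\mathcal H$. Let $\mathcal H=\{h_\alpha:\alpha<\omega_1\}$ be a coherent family of partial functions from $\omega$ to $\omega$ such that $\mathrm{dom}(h_\alpha)\setminus\mathrm{dom}(h_\beta)$ is finite for all $\alpha<\beta<\omega_1$, and such that there is no total function $h\in\omega^\omega$ for which $\mathcal H\cup\{h\}$ is coherent. Let $Q(\mathcal H)$ be the poset of all pairs $q=(\{s^q_\rho:\rho\in 2^{\le n_q}\},\Gamma_q)$ such that 1. $n_q\in\omega$, each $s^q_\rho$ is a finite subset of $\omega$, and $\Gamma_q$ is a finite subset of $\omega_1$; 2. for all $\alpha\ne\beta$ in $\Gamma_q$ and $\rho\in 2^{n_q}$, the union $(h_\alpha\restriction s^q_\rho)\cup(h_\beta\restriction s^q_\rho)$ is not a function; 3. for each $\rho\in 2^{n_q}$, $s^q_{\rho\restriction j}\subseteq s^q_{\rho\restriction k}$ whenever $j\le k\le n_q$; 4. for all $\rho,\psi\in 2^{n_q}$, $s^q_\rho\cap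 s^q_\psi=s^q_{\rho\restriction j}$, where $j\le n_q$ is maximal with $\rho\restriction j=\psi\restriction j$; ordered by $q\le r$ if and only if $n_q\ge n_r$, $\Gamma_q\supseteq\Gamma_r$ and $s^q_\rho=s^r_\rho$ for all $\rho\in 2^{n_r}$. Then $Q(\mathcal H)$ is ccc (every antichain is countable). Furthermore, there is a condition $q\in Q(\mathcal H)$ which forces that there are an uncountable $\Gamma\subseteq\omega_1$ and an uncountable almost disjoint family $\mathcal A$ of infinite subsets of $\omega$ such that, for each $a\in\mathcal A$, the family $\{h_\alpha\restriction a:\alpha\in\Gamma\}$ is Luzin incoherent, that is, for all $\alpha<\beta$ in $\Gamma$ the union $(h_\alpha\restriction a)\cup(h_\beta\restriction a)$ is not a function. -/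

import Mathlib

/-! ## Coherent families of partial functions -/

/-- The first uncountable ordinal, as a well-ordered type. -/
abbrev Omega1 : Type := (Ordinal.omega 1 : Ordinal.{0}).ToType

/-- A family of partial functions on `ω` is coherent if any two members differ at only finitely
many points of their common domain. -/
def Coherent (H : Set (ℕ →. ℕ)) : Prop :=
  ∀ f ∈ H, ∀ g ∈ H, {n : ℕ | ∃ x ∈ f n, ∃ y ∈ g n, x ≠ y}.Finite

/-- The domains of `h α` increase modulo finite sets. -/
def ModFiniteIncreasingDoms (h : Omega1 → (ℕ →. ℕ)) : Prop :=
  ∀ α β : Omega1, α < β → ((h α).Dom \ (h β).Dom).Finite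

/-- The set of pairs `(f ↾ s) ∪ (g ↾ s)`. -/
def unionRestrict (f g : ℕ →. ℕ) (s : Set ℕ) : Set (ℕ × ℕ) :=
  {z | z.1 ∈ s ∧ (z.2 ∈ f z.1 ∨ z.2 ∈ g z.1)}

/-- A set of pairs is (the graph of) a function. -/
def IsFunctionGraph (R : Set (ℕ × ℕ)) : Prop :=
  ∀ n x y, (n, x) ∈ R → (n, y) ∈ R → x = y

/-! ## Partial orders as forcing notions -/

/-- Two conditions are compatible if they have a common extension. -/
def Compatible {P : Type*} [Preorder P] (p q : P) : Prop :=
  ∃ r : P, r ≤ p ∧ r ≤ q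

/-- The countable chain condition: every antichain is countable. -/
def IsCCC (P : Type*) [Preorder P] : Prop :=
  ∀ A : Set P, (∀ p ∈ A, ∀ q ∈ A, p ≠ q → ¬ Compatible p q) → A.Countable

/-! ## The poset `Q(H)` -/

/-- Conditions of `Q(H)` for `H = {h α : α < ω₁}`. Finite binary sequences are lists of Booleans and
`ρ ↾ j` is `ρ.take j`. The system `s ρ` is indexed by the sequences of length at most `n`; the
field `s_out` only fixes the irrelevant values at longer lists. -/
@[ext]
structure QPoset (h : Omega1 → (ℕ →. ℕ)) where
  n : ℕ
  s : List Bool → Finset ℕ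
  Γ : Finset Omega1
  s_out : ∀ ρ : List Bool, n < ρ.length → s ρ = ∅
  not_function : ∀ α ∈ Γ, ∀ β ∈ Γ, α ≠ β → ∀ ρ : List Bool, ρ.length = n →
    ¬ IsFunctionGraph (unionRestrict (h α) (h β) (s ρ))
  increasing : ∀ ρ : List Bool, ρ.length = n → ∀ j k : ℕ, j ≤ k → k ≤ n →
    s (ρ.take j) ⊆ s (ρ.take k)
  inter_eq : ∀ ρ ψ : List Bool, ρ.length = n → ψ.length = n → ∀ j : ℕ,
    IsGreatest {i : ℕ | i ≤ n ∧ ρ.take i = ψ.take i} j → s ρ ∩ s ψ = s (ρ.take j)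

namespace QPoset

variable {h : Omega1 → (ℕ →. ℕ)}

/-- `q` extends `r`. -/
protected def le (q r : QPoset h) : Prop :=
  r.n ≤ q.n ∧ r.Γ ⊆ q.Γ ∧ ∀ ρ : List Bool, ρ.length = r.n → q.s ρ = r.s ρ

/-- The values at the top level determine all the values below: a node of smaller length is
the splitting node of two sequences of full length. -/
theorem exists_split (r : QPoset h) (σ : List Bool) (hσ : σ.length < r.n) :
    ∃ ρ ψ : List Bool, ρ.length = r.n ∧ ψ.length = r.n ∧ ρ.take σ.length = σ ∧
      IsGreatest {i : ℕ | i ≤ r.n ∧ ρ.take i = ψ.take i} σ.length := by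
  refine ⟨σ ++ true :: List.replicate (r.n - σ.length - 1) true,
    σ ++ false :: List.replicate (r.n - σ.length - 1) true, ?_, ?_, ?_, ⟨?_, ?_⟩, ?_⟩
  · simp; omega
  · simp; omega
  · simp
  · omega
  · simp
  · rintro i ⟨_, hi⟩
    by_contra hlt
    push Not at hlt
    have := congrArg (fun l : List Bool => l[σ.length]?) hi
    simp [hlt] at this

theorem s_eq_of_le {q r : QPoset h} (hqr : QPoset.le q r) (σ : List Bool)
    (hσ : σ.length ≤ r.n) : q.s σ = r.s σ := by
  obtain ⟨hn, _, hs⟩ := hqr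
  rcases hσ.eq_or_lt with heq | hlt
  · exact hs σ heq
  obtain ⟨ρ, ψ, hρ, hψ, hσρ, hg⟩ := r.exists_split σ hlt
  have e1 := r.inter_eq ρ ψ hρ hψ _ hg
  rw [hσρ] at e1
  have pad : ∀ (τ : List Bool), τ.length = r.n →
      (τ ++ List.replicate (q.n - r.n) true).length = q.n := by
    intro τ hτ; simp; omega
  -- pass to sequences of length `q.n` and use that the systems increase along branches
  have sub : ∀ τ : List Bool, τ.length = r.n →
      q.s τ ⊆ q.s (τ ++ List.replicate (q.n - r.n) true) ∧
      q.s (τ.take σ.length) ⊆ q.s τ := by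
    intro τ hτ
    have h1 := q.increasing _ (pad τ hτ) r.n q.n hn le_rfl
    have h2 := q.increasing _ (pad τ hτ) σ.length r.n hlt.le hn
    rw [List.take_of_length_le (pad τ hτ).le, List.take_append_of_le_length hτ.ge,
      List.take_of_length_le hτ.le] at h1
    rw [List.take_append_of_le_length (by omega), List.take_append_of_le_length hτ.ge,
      List.take_of_length_le hτ.le] at h2
    exact ⟨h1, h2⟩
  have hg' : IsGreatest {i : ℕ | i ≤ q.n ∧
      (ρ ++ List.replicate (q.n - r.n) true).take i =
      (ψ ++ List.replicate (q.n - r.n) true).take i} σ.length := by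
    refine ⟨⟨by omega, ?_⟩, ?_⟩
    · rw [List.take_append_of_le_length (by omega), List.take_append_of_le_length (by omega)]
      exact hg.1.2
    · rintro i ⟨_, hi⟩
      by_contra hc
      push Not at hc
      have hk : min i r.n ∈ {i : ℕ | i ≤ r.n ∧ ρ.take i = ψ.take i} := by
        refine ⟨min_le_right _ _, ?_⟩
        have := congrArg (List.take r.n) hi
        rw [List.take_take, List.take_take, List.take_append_of_le_length (by omega),
          List.take_append_of_le_length (by omega), min_comm] at this
        exact this
      have := hg.2 hk
      omega
  have e2 := q.inter_eq _ _ (pad ρ hρ) (pad ψ hψ) _ hg'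
  rw [List.take_append_of_le_length (by omega), hσρ] at e2
  apply Finset.Subset.antisymm
  · rw [← e1, ← hs ρ hρ, ← hs ψ hψ]
    have a1 := (sub ρ hρ).2
    have a2 := (sub ψ hψ).2
    rw [← hg.1.2, hσρ] at a2
    rw [hσρ] at a1
    exact Finset.subset_inter a1 a2
  · rw [← e1, ← hs ρ hρ, ← hs ψ hψ, ← e2]
    exact Finset.inter_subset_inter (sub ρ hρ).1 (sub ψ hψ).1

instance : Preorder (QPoset h) where
  le := QPoset.le
  le_refl r := ⟨le_rfl, Finset.Subset.refl _, fun _ _ => rfl⟩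
  le_trans q r t hqr hrt := by
    refine ⟨hrt.1.trans hqr.1, hrt.2.1.trans hqr.2.1, fun ρ hρ => ?_⟩
    rw [s_eq_of_le hqr ρ (hρ.le.trans hrt.1), hrt.2.2 ρ hρ]

end QPoset

/-! ## Names and the forcing relation -/

universe u

/-- `P`-names: a name is a (small) set of pairs (name, condition). -/
inductive PName (P : Type u) : Type (u + 1)
  | mk (ι : Type u) (x : ι → PName P) (c : ι → P) : PName P

/-- Formulas of the forcing language (set theory with the names as constants). A quantified formula
is given by its instances at all names. -/
inductive Formula (P : Type u) : Type (u + 1)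
  | mem (x y : PName P) : Formula P
  | eq (x y : PName P) : Formula P
  | neg (φ : Formula P) : Formula P
  | and (φ ψ : Formula P) : Formula P
  | all (φ : PName P → Formula P) : Formula P

namespace PName

variable {P : Type u} [Preorder P]

/-- `p ⊩ x = y`: below `p`, every member of `x` is densely equal to a member of `y` and conversely. -/
def ForcesEq : PName P → PName P → P → Prop
  | mk ι x c, mk κ y d => fun p =>
    (∀ i : ι, ∀ q, q ≤ p → q ≤ c i → ∃ r, r ≤ q ∧ ∃ j : κ, r ≤ d j ∧ ForcesEq (x i) (y j) r) ∧
    (∀ j : κ, ∀ q, q ≤ p → q ≤ d j → ∃ r, r ≤ q ∧ ∃ i : ι, r ≤ c i ∧ ForcesEq (x i) (y j) r)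

/-- `p ⊩ x ∈ y`: it is dense below `p` that `x` equals some member of `y`. -/
def ForcesMem (x : PName P) : PName P → P → Prop
  | mk κ y d => fun p => ∀ q, q ≤ p → ∃ r, r ≤ q ∧ ∃ j : κ, r ≤ d j ∧ ForcesEq x (y j) r

end PName

/-- The forcing relation `p ⊩ φ`. -/
def Forces {P : Type u} [Preorder P] (p : P) : Formula P → Prop
  | .mem x y => PName.ForcesMem x y p
  | .eq x y => PName.ForcesEq x y p
  | .neg φ => ∀ q, q ≤ p → ¬ Forces q φ
  | .and φ ψ => Forces p φ ∧ Forces p ψ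
  | .all φ => ∀ x : PName P, Forces p (φ x)

/-! ### Canonical names -/

namespace PName

variable {P : Type u}

/-- The name for the set whose members are (the values of) the names `x i`. -/
def ofFamily {ι : Type u} (x : ι → PName P) : PName P :=
  mk (ι × P) (fun t => x t.1) (fun t => t.2)

/-- The name for the unordered pair `{x, y}`. -/
def upair (x y : PName P) : PName P :=
  ofFamily (ι := ULift.{u} Bool) fun b => if b.down then x else y

/-- The name for the ordered pair `(x, y) = {{x}, {x, y}}`. -/
def opair (x y : PName P) : PName P :=
  upair (upair x x) (upair x y)

end PName

/-- The canonical name for the von Neumann ordinal `{b : b < a}` of an element `a` of a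
well-ordered type. -/
noncomputable def checkElem (P : Type) {W : Type} [LinearOrder W] [WellFoundedLT W] :
    W → PName P :=
  (wellFounded_lt (α := W)).fix fun a rec =>
    PName.ofFamily fun b : {b : W // b < a} => rec b.1 b.2

theorem checkElem_eq (P : Type) {W : Type} [LinearOrder W] [WellFoundedLT W] (a : W) :
    checkElem P a = PName.ofFamily fun b : {b : W // b < a} => checkElem P b.1 :=
  (wellFounded_lt (α := W)).fix_eq _ a

/-- The canonical name for the ordinal that is the order type of `W`. -/
noncomputable def checkOrd (P : Type) (W : Type) [LinearOrder W] [WellFoundedLT W] : PName P :=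
  PName.ofFamily fun a : W => checkElem P a

/-- The canonical name for the sequence `⟨h α : α < ω₁⟩`, as the set of all `(α, (n, k))` such that
`h α` takes the value `k` at `n`. -/
noncomputable def checkSeq (P : Type) (h : Omega1 → (ℕ →. ℕ)) : PName P :=
  PName.ofFamily fun t : {t : Omega1 × ℕ × ℕ // t.2.2 ∈ h t.1 t.2.1} =>
    PName.opair (checkElem P t.1.1) (PName.opair (checkElem P t.1.2.1) (checkElem P t.1.2.2))

/-! ### Set-theoretic formulas -/

namespace Formula

variable {P : Type u}

/-- Disjunction. -/
def or (φ ψ : Formula P) : Formula P := neg (and (neg φ) (neg ψ))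

/-- Implication. -/
def imp (φ ψ : Formula P) : Formula P := neg (and φ (neg ψ))

/-- Existential quantifier. -/
def ex (φ : PName P → Formula P) : Formula P := neg (all fun x => neg (φ x))

/-- `∀ x ∈ y, φ x` -/
def allIn (y : PName P) (φ : PName P → Formula P) : Formula P := all fun x => imp (mem x y) (φ x)

/-- `∃ x ∈ y, φ x` -/
def exIn (y : PName P) (φ : PName P → Formula P) : Formula P := ex fun x => and (mem x y) (φ x)

/-- `x ⊆ y` -/
def subset (x y : PName P) : Formula P := allIn x fun z => mem z y

/-- The binary relation `R` is single-valued: `∀ x y z, R x y ∧ R x z → y = z`. -/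
def singleValued (R : PName P → PName P → Formula P) : Formula P :=
  all fun x => all fun y => all fun z => imp (and (R x y) (R x z)) (eq y z)

/-- The relation `f` maps a part of `k` onto a superset of the class `X`: it is single-valued and
each `y` in `X` is the value of `f` at some `i ∈ k`. -/
def coveredBy (f k : PName P) (X : PName P → Formula P) : Formula P :=
  and (singleValued fun i y => mem (PName.opair i y) f)
    (all fun y => imp (X y) (exIn k fun i => mem (PName.opair i y) f))

/-- `X` is countable, where `w` is a name for `ω`. -/
def countable (w : PName P) (X : PName P → Formula P) : Formula P :=
  ex fun f => coveredBy f w X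

/-- `X` is finite, where `w` is a name for `ω`: it is covered by the values of a function on
some `k ∈ ω`. -/
def finite (w : PName P) (X : PName P → Formula P) : Formula P :=
  exIn w fun k => ex fun f => coveredBy f k X

/-- `A` is an almost disjoint family of infinite subsets of `ω`. -/
def almostDisjointFamily (w A : PName P) : Formula P :=
  and (allIn A fun a => and (subset a w) (neg (finite w fun n => mem n a)))
    (allIn A fun a => allIn A fun b =>
      imp (neg (eq a b)) (finite w fun n => and (mem n a) (mem n b)))

/-- `(n, k)` belongs to `(h α ↾ a) ∪ (h β ↾ a)`, where `H` is a name for the sequence `h`. -/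
def inUnionRestrict (H α β a n k : PName P) : Formula P :=
  and (mem n a) (or (mem (PName.opair α (PName.opair n k)) H)
    (mem (PName.opair β (PName.opair n k)) H))

/-- `{h α ↾ a : α ∈ Γ}` is Luzin incoherent: for all `α < β` in `Γ`, the union
`(h α ↾ a) ∪ (h β ↾ a)` is not a function. -/
def luzinIncoherent (H Γ a : PName P) : Formula P :=
  allIn Γ fun α => allIn Γ fun β => imp (mem α β)
    (neg (singleValued fun n k => inUnionRestrict H α β a n k))

end Formula

/-- The formula: there are an uncountable `Γ ⊆ ω₁` and an uncountable almost disjoint family `A` of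
infinite subsets of `ω` such that `{h α ↾ a : α ∈ Γ}` is Luzin incoherent for each `a ∈ A`. -/
noncomputable def existsLuzinRestrictions (P : Type) (h : Omega1 → (ℕ →. ℕ)) : Formula P :=
  let w : PName P := checkOrd P ℕ
  .ex fun Γ => .ex fun A =>
    .and (.and (.subset Γ (checkOrd P Omega1)) (.neg (.countable w fun α => .mem α Γ)))
      (.and (.and (.almostDisjointFamily w A) (.neg (.countable w fun a => .mem a A)))
        (.allIn A fun a => .luzinIncoherent (checkSeq P h) Γ a))

/-! Conditions with the same system are merged by adding one new point above each top node, taken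
from a large common disagreement of the new indices of one condition with those of the other. If an
uncountable antichain existed, its members could be thinned out to share the system and a root `R`
of their sets of indices, with the rest `Γ \ R` of these sets unbounded in `ω₁`. The common part `f`
of the `h α` with `α ∈ Γ \ R` almost includes every `h β` with `β` below `Γ \ R`. Were the
disagreements of these functions `f` bounded in size, two condensation points `ξ`, `η` of the family
with a disagreement `D` of maximal size would have neighbourhoods between which all disagreements
equal `D`. Off `D`, any function from the one and any from the other then agree where both are
defined, so that their common values define a total function which almost includes every `h α`,
contrary to the hypothesis on `h`.

By the chain condition, some condition forces the union of the sets `Γ` in the generic filter to be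
uncountable. The sets obtained along the ground model branches of the binary tree are infinite by
density and almost disjoint by the intersection requirement on the systems, and their Luzin
incoherence is what the second requirement on conditions says. -/

namespace PName

variable {P : Type u} [Preorder P]

theorem ForcesEq.mono {x y : PName P} {p q : P} (h : ForcesEq x y p) (hq : q ≤ p) :
    ForcesEq x y q := by
  cases x; cases y
  exact ⟨fun i r hr => h.1 i r (hr.trans hq), fun j r hr => h.2 j r (hr.trans hq)⟩

theorem ForcesEq.refl (x : PName P) (p : P) : ForcesEq x x p := by
  induction x generalizing p with
  | mk ι x c ih =>
    exact ⟨fun i q _ hc => ⟨q, le_rfl, i, hc, ih i q⟩, fun i q _ hc => ⟨q, le_rfl, i, hc, ih i q⟩⟩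

theorem ForcesEq.symm {x y : PName P} {p : P} (h : ForcesEq x y p) : ForcesEq y x p := by
  induction x generalizing y p with
  | mk ι x c ih =>
    cases y
    refine ⟨fun j q hq hd => ?_, fun i q hq hc => ?_⟩
    · obtain ⟨r, hr, i, hi, e⟩ := h.2 j q hq hd
      exact ⟨r, hr, i, hi, ih i e⟩
    · obtain ⟨r, hr, j, hj, e⟩ := h.1 i q hq hc
      exact ⟨r, hr, j, hj, ih i e⟩

theorem ForcesEq.trans {x y z : PName P} {p : P} (h₁ : ForcesEq x y p) (h₂ : ForcesEq y z p) :
    ForcesEq x z p := by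
  induction x generalizing y z p with
  | mk ι x c ih =>
    cases y; cases z
    refine ⟨fun i q hq hc => ?_, fun k q hq he => ?_⟩
    · obtain ⟨r, hr, j, hj, e⟩ := h₁.1 i q hq hc
      obtain ⟨r', hr', k, hk, e'⟩ := h₂.1 j r (hr.trans hq) hj
      exact ⟨r', hr'.trans hr, k, hk, ih i (e.mono hr') e'⟩
    · obtain ⟨r, hr, j, hj, e⟩ := h₂.2 k q hq he
      obtain ⟨r', hr', i, hi, e'⟩ := h₁.2 j r (hr.trans hq) hj
      exact ⟨r', hr'.trans hr, i, hi, ih i e' (e.mono hr')⟩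

theorem ForcesEq.of_dense {x y : PName P} {p : P}
    (h : ∀ q ≤ p, ∃ r ≤ q, ForcesEq x y r) : ForcesEq x y p := by
  cases x; cases y
  refine ⟨fun i q hq hc => ?_, fun j q hq hd => ?_⟩
  · obtain ⟨r, hr, e⟩ := h q hq
    obtain ⟨r', hr', j, hj, e'⟩ := e.1 i r le_rfl (hr.trans hc)
    exact ⟨r', hr'.trans hr, j, hj, e'⟩
  · obtain ⟨r, hr, e⟩ := h q hq
    obtain ⟨r', hr', j, hj, e'⟩ := e.2 j r le_rfl (hr.trans hd)
    exact ⟨r', hr'.trans hr, j, hj, e'⟩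

theorem ForcesMem.mono {x y : PName P} {p q : P} (h : ForcesMem x y p) (hq : q ≤ p) :
    ForcesMem x y q := by
  cases y
  exact fun r hr => h r (hr.trans hq)

theorem ForcesMem.of_dense {x y : PName P} {p : P}
    (h : ∀ q ≤ p, ∃ r ≤ q, ForcesMem x y r) : ForcesMem x y p := by
  cases y
  intro q hq
  obtain ⟨r, hr, e⟩ := h q hq
  obtain ⟨r', hr', e'⟩ := e r le_rfl
  exact ⟨r', hr'.trans hr, e'⟩

theorem ForcesMem.congr_left {x x' y : PName P} {p : P} (h : ForcesMem x y p)
    (e : ForcesEq x x' p) : ForcesMem x' y p := by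
  cases y
  intro q hq
  obtain ⟨r, hr, j, hj, e'⟩ := h q hq
  exact ⟨r, hr, j, hj, (e.mono (hr.trans hq)).symm.trans e'⟩

theorem ForcesMem.congr_right {x y y' : PName P} {p : P} (h : ForcesMem x y p)
    (e : ForcesEq y y' p) : ForcesMem x y' p := by
  cases y; cases y'
  intro q hq
  obtain ⟨r, hr, j, hj, e'⟩ := h q hq
  obtain ⟨r', hr', k, hk, e''⟩ := e.1 j r (hr.trans hq) hj
  exact ⟨r', hr'.trans hr, k, hk, (e'.mono hr').trans e''⟩

theorem forcesMem_mk {ι : Type u} (x : ι → PName P) (c : ι → P) (i : ι) {p : P} (h : p ≤ c i) :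
    ForcesMem (x i) (mk ι x c) p :=
  fun q hq => ⟨q, le_rfl, i, hq.trans h, ForcesEq.refl _ _⟩

theorem ForcesEq.of_mem {x y : PName P} {p : P}
    (h₁ : ∀ z, ∀ q ≤ p, ForcesMem z x q → ForcesMem z y q)
    (h₂ : ∀ z, ∀ q ≤ p, ForcesMem z y q → ForcesMem z x q) : ForcesEq x y p := by
  cases x with
  | mk ι x c =>
    cases y with
    | mk κ y d =>
      refine ⟨fun i q hq hc => h₁ _ q hq (forcesMem_mk x c i hc) q le_rfl, fun j q hq hd => ?_⟩
      obtain ⟨r, hr, i, hi, e⟩ := h₂ _ q hq (forcesMem_mk y d j hd) q le_rfl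
      exact ⟨r, hr, i, hi, e.symm⟩

theorem forcesMem_ofFamily {ι : Type u} {x : ι → PName P} {z : PName P} {p : P} :
    ForcesMem z (ofFamily x) p ↔ ∀ q ≤ p, ∃ r ≤ q, ∃ i, ForcesEq z (x i) r := by
  refine forall_congr' fun q => forall_congr' fun _ => ⟨?_, ?_⟩
  · rintro ⟨r, hr, i, _, e⟩
    exact ⟨r, hr, i.1, e⟩
  · rintro ⟨r, hr, i, e⟩
    exact ⟨r, hr, (i, r), le_rfl, e⟩

theorem forcesMem_ofFamily_self {ι : Type u} (x : ι → PName P) (i : ι) (p : P) :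
    ForcesMem (x i) (ofFamily x) p :=
  forcesMem_ofFamily.2 fun q _ => ⟨q, le_rfl, i, ForcesEq.refl _ _⟩

theorem forcesMem_upair {x y z : PName P} {p : P} :
    ForcesMem z (upair x y) p ↔ ∀ q ≤ p, ∃ r ≤ q, ForcesEq z x r ∨ ForcesEq z y r := by
  unfold upair
  rw [forcesMem_ofFamily]
  refine forall_congr' fun q => forall_congr' fun _ => exists_congr fun r =>
    and_congr_right fun _ => ⟨?_, ?_⟩
  · rintro ⟨⟨_ | _⟩, e⟩
    · exact .inr e
    · exact .inl e
  · rintro (e | e)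
    · exact ⟨⟨true⟩, e⟩
    · exact ⟨⟨false⟩, e⟩

theorem forcesMem_upair_left (x y : PName P) (p : P) : ForcesMem x (upair x y) p :=
  forcesMem_upair.2 fun q _ => ⟨q, le_rfl, .inl (ForcesEq.refl _ _)⟩

theorem forcesMem_upair_right (x y : PName P) (p : P) : ForcesMem y (upair x y) p :=
  forcesMem_upair.2 fun q _ => ⟨q, le_rfl, .inr (ForcesEq.refl _ _)⟩

theorem forcesMem_singleton {x z : PName P} {p : P} :
    ForcesMem z (upair x x) p ↔ ForcesEq z x p := by
  rw [forcesMem_upair]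
  simp only [or_self]
  exact ⟨ForcesEq.of_dense, fun h q hq => ⟨q, le_rfl, h.mono hq⟩⟩

theorem ForcesEq.upair {x x' y y' : PName P} {p : P} (hx : ForcesEq x x' p)
    (hy : ForcesEq y y' p) : ForcesEq (upair x y) (upair x' y') p := by
  refine ForcesEq.of_mem ?_ ?_ <;> intro z q hq hz <;> rw [forcesMem_upair] at hz ⊢ <;>
    intro q' hq' <;> obtain ⟨r, hr, h⟩ := hz q' hq' <;> have hrp := hr.trans (hq'.trans hq)
  · exact ⟨r, hr, h.imp (·.trans (hx.mono hrp)) (·.trans (hy.mono hrp))⟩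
  · exact ⟨r, hr, h.imp (·.trans (hx.mono hrp).symm) (·.trans (hy.mono hrp).symm)⟩

theorem ForcesEq.opair {x x' y y' : PName P} {p : P} (hx : ForcesEq x x' p)
    (hy : ForcesEq y y' p) : ForcesEq (opair x y) (opair x' y') p :=
  (hx.upair hx).upair (hx.upair hy)

theorem ForcesEq.opair_fst {x x' y y' : PName P} {p : P}
    (h : ForcesEq (PName.opair x y) (PName.opair x' y') p) : ForcesEq x x' p := by
  refine ForcesEq.of_dense fun q hq => ?_
  have hmem := (forcesMem_upair_left (PName.upair x x) (PName.upair x y) q).congr_right (h.mono hq)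
  obtain ⟨r, hr, e⟩ := forcesMem_upair.1 hmem q le_rfl
  refine ⟨r, hr, ?_⟩
  rcases e with e | e
  · exact (forcesMem_singleton.1 ((forcesMem_upair_left x' x' r).congr_right e.symm)).symm
  · exact (forcesMem_singleton.1 ((forcesMem_upair_left x' y' r).congr_right e.symm)).symm

theorem ForcesEq.opair_snd_dense {x x' y y' : PName P} {p : P}
    (h : ForcesEq (PName.opair x y) (PName.opair x' y') p) :
    ∃ r ≤ p, ForcesEq y x' r ∨ ForcesEq y y' r := by
  have hmem := (forcesMem_upair_right (PName.upair x x) (PName.upair x y) p).congr_right h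
  obtain ⟨r, hr, e⟩ := forcesMem_upair.1 hmem p le_rfl
  rcases e with e | e
  · exact ⟨r, hr, .inl (forcesMem_singleton.1 ((forcesMem_upair_right x y r).congr_right e))⟩
  · obtain ⟨r', hr', e'⟩ :=
      forcesMem_upair.1 ((forcesMem_upair_right x y r).congr_right e) r le_rfl
    exact ⟨r', hr'.trans hr, e'⟩

theorem ForcesEq.opair_snd {x x' y y' : PName P} {p : P}
    (h : ForcesEq (PName.opair x y) (PName.opair x' y') p) : ForcesEq y y' p := by
  refine ForcesEq.of_dense fun q hq => ?_
  obtain ⟨r, hr, e⟩ := (h.mono hq).opair_snd_dense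
  obtain ⟨r', hr', e'⟩ := (h.mono (hr.trans hq)).symm.opair_snd_dense
  refine ⟨r', hr'.trans hr, ?_⟩
  rcases e with e | e
  · rcases e' with e' | e'
    · exact (e.mono hr').trans ((h.opair_fst.mono (hr'.trans (hr.trans hq))).symm.trans e'.symm)
    · exact e'.symm
  · exact e.mono hr'

theorem ForcesMem.opair_congr_left {x x' y z : PName P} {p : P}
    (h : ForcesMem (PName.opair x y) z p) (e : ForcesEq x x' p) :
    ForcesMem (PName.opair x' y) z p :=
  h.congr_left (e.opair (.refl _ _))

end PName

open PName

/-- The names `t i` are forced to denote pairwise distinct objects. -/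
def ForcedDistinct {P : Type u} [Preorder P] {I : Type*} (t : I → PName P) : Prop :=
  ∀ ⦃i j p⦄, ForcesEq (t i) (t j) p → i = j

section Check

variable {P W : Type} [Preorder P] [LinearOrder W] [WellFoundedLT W]

theorem forcesMem_checkElem {a : W} {z : PName P} {p : P} :
    ForcesMem z (checkElem P a) p ↔ ∀ q ≤ p, ∃ r ≤ q, ∃ b < a, ForcesEq z (checkElem P b) r := by
  rw [checkElem_eq, forcesMem_ofFamily]
  simp

theorem forcesMem_checkElem_of_lt {a b : W} (h : b < a) (p : P) :
    ForcesMem (checkElem P b) (checkElem P a) p :=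
  forcesMem_checkElem.2 fun q _ => ⟨q, le_rfl, b, h, ForcesEq.refl _ _⟩

theorem not_forcesMem_checkElem_self (a : W) (p : P) :
    ¬ ForcesMem (checkElem P a) (checkElem P a) p := by
  induction a using WellFoundedLT.induction generalizing p with
  | ind a ih =>
    intro h
    obtain ⟨r, -, b, hb, e⟩ := forcesMem_checkElem.1 h p le_rfl
    exact ih b hb r ((forcesMem_checkElem_of_lt hb r).congr_right e)

theorem forcedDistinct_checkElem : ForcedDistinct (checkElem P : W → PName P) := by
  intro a b p h
  rcases lt_trichotomy a b with hab | rfl | hab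
  · exact absurd ((forcesMem_checkElem_of_lt hab p).congr_right h.symm)
      (not_forcesMem_checkElem_self _ _)
  · rfl
  · exact absurd ((forcesMem_checkElem_of_lt hab p).congr_right h)
      (not_forcesMem_checkElem_self _ _)

theorem lt_of_forcesMem_checkElem {a b : W} {p : P}
    (h : ForcesMem (checkElem P a) (checkElem P b) p) : a < b := by
  obtain ⟨r, -, c, hc, e⟩ := forcesMem_checkElem.1 h p le_rfl
  exact forcedDistinct_checkElem e ▸ hc

end Check

section Forces

variable {P : Type u} [Preorder P]

theorem Forces.mono {φ : Formula P} {p q : P} (h : Forces p φ) (hq : q ≤ p) : Forces q φ := by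
  induction φ with
  | mem x y => exact ForcesMem.mono h hq
  | eq x y => exact ForcesEq.mono h hq
  | neg φ _ => exact fun r hr => h r (hr.trans hq)
  | and φ ψ ih₁ ih₂ => exact ⟨ih₁ h.1, ih₂ h.2⟩
  | all φ ih => exact fun x => ih x (h x)

theorem Forces.of_dense {φ : Formula P} {p : P} (h : ∀ q ≤ p, ∃ r ≤ q, Forces r φ) :
    Forces p φ := by
  induction φ generalizing p with
  | mem x y => exact ForcesMem.of_dense h
  | eq x y => exact ForcesEq.of_dense h
  | neg φ _ =>
    intro q hq hφ
    obtain ⟨r, hr, hn⟩ := h q hq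
    exact hn r le_rfl (hφ.mono hr)
  | and φ ψ ih₁ ih₂ =>
    refine ⟨ih₁ fun q hq => ?_, ih₂ fun q hq => ?_⟩ <;> obtain ⟨r, hr, hn⟩ := h q hq
    exacts [⟨r, hr, hn.1⟩, ⟨r, hr, hn.2⟩]
  | all φ ih =>
    refine fun x => ih x fun q hq => ?_
    obtain ⟨r, hr, hn⟩ := h q hq
    exact ⟨r, hr, hn x⟩

theorem forces_imp {φ ψ : Formula P} {p : P} :
    Forces p (.imp φ ψ) ↔ ∀ q ≤ p, Forces q φ → Forces q ψ := by
  constructor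
  · intro h q hq hφ
    refine Forces.of_dense fun q' hq' => ?_
    by_contra! hc
    exact h q' (hq'.trans hq) ⟨hφ.mono hq', hc⟩
  · rintro h q hq ⟨h₁, h₂⟩
    exact h₂ q le_rfl (h q hq h₁)

theorem forces_ex {φ : PName P → Formula P} {p : P} :
    Forces p (.ex φ) ↔ ∀ q ≤ p, ∃ r ≤ q, ∃ x, Forces r (φ x) := by
  constructor
  · intro h q hq
    by_contra! hc
    exact h q hq fun x r hr => hc r hr x
  · intro h q hq hn
    obtain ⟨r, hr, x, hx⟩ := h q hq
    exact hn x r hr hx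

theorem Forces.ex {φ : PName P → Formula P} {p : P} (x : PName P) (h : Forces p (φ x)) :
    Forces p (.ex φ) :=
  forces_ex.2 fun q hq => ⟨q, le_rfl, x, h.mono hq⟩

theorem Forces.or {φ ψ : Formula P} {p : P} (h : Forces p φ ∨ Forces p ψ) :
    Forces p (.or φ ψ) := by
  rintro q hq ⟨h₁, h₂⟩
  exact h.elim (fun h => h₁ q le_rfl (h.mono hq)) fun h => h₂ q le_rfl (h.mono hq)

theorem forces_allIn {y : PName P} {φ : PName P → Formula P} {p : P} :
    Forces p (.allIn y φ) ↔ ∀ x, ∀ q ≤ p, ForcesMem x y q → Forces q (φ x) :=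
  forall_congr' fun _ => forces_imp

theorem forces_exIn {y : PName P} {φ : PName P → Formula P} {p : P} :
    Forces p (.exIn y φ) ↔ ∀ q ≤ p, ∃ r ≤ q, ∃ x, ForcesMem x y r ∧ Forces r (φ x) :=
  forces_ex

theorem forces_singleValued {R : PName P → PName P → Formula P} {p : P} :
    Forces p (.singleValued R) ↔
      ∀ x y z, ∀ q ≤ p, Forces q (R x y) → Forces q (R x z) → ForcesEq y z q :=
  forall_congr' fun _ => forall_congr' fun _ => forall_congr' fun _ => forces_imp.trans
    (forall_congr' fun _ => forall_congr' fun _ =>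
      ⟨fun h h₁ h₂ => h ⟨h₁, h₂⟩, fun h h' => h h'.1 h'.2⟩)

theorem forces_coveredBy {f k : PName P} {X : PName P → Formula P} {p : P} :
    Forces p (.coveredBy f k X) ↔
      (∀ x y z, ∀ q ≤ p, ForcesMem (opair x y) f q → ForcesMem (opair x z) f q →
        ForcesEq y z q) ∧
      ∀ y, ∀ q ≤ p, Forces q (X y) → ∃ r ≤ q, ∃ i, ForcesMem i k r ∧ ForcesMem (opair i y) f r := by
  refine and_congr forces_singleValued (forall_congr' fun y => forces_imp.trans
    ⟨fun h q hq hX => forces_exIn.1 (h q hq hX) q le_rfl, fun h q hq hX => forces_exIn.2 ?_⟩)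
  exact fun q' hq' => h q' (hq'.trans hq) (hX.mono hq')

end Forces

/-! ### Finiteness and countability in the forcing language -/

section Cardinality

variable {P : Type} [Preorder P] {W : Type} [LinearOrder W] [WellFoundedLT W]

/-- The canonical name for the identity function on the ordinal `{b : b < a}`, which witnesses that
the parts of a natural number are finite. -/
noncomputable def checkId (P : Type) (a : W) : PName P :=
  ofFamily fun b : {b : W // b < a} => opair (checkElem P b.1) (checkElem P b.1)

theorem forcesMem_opair_checkId {a : W} {x y : PName P} {p : P} :
    ForcesMem (opair x y) (checkId P a) p ↔ ForcesEq x y p ∧ ForcesMem y (checkElem P a) p := by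
  rw [checkId, forcesMem_ofFamily, forcesMem_checkElem]
  constructor
  · refine fun h => ⟨.of_dense fun q hq => ?_, fun q hq => ?_⟩ <;>
      obtain ⟨r, hr, b, e⟩ := h q hq
    · exact ⟨r, hr, e.opair_fst.trans e.opair_snd.symm⟩
    · exact ⟨r, hr, b, b.2, e.opair_snd⟩
  · rintro ⟨hxy, hy⟩ q hq
    obtain ⟨r, hr, b, hb, e⟩ := hy q hq
    exact ⟨r, hr, ⟨b, hb⟩, ((hxy.mono (hr.trans hq)).trans e).opair e⟩

theorem forces_coveredBy_checkId {a : W} {X : PName P → Formula P} {p : P}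
    (hX : ∀ z, ∀ q ≤ p, Forces q (X z) → ForcesMem z (checkElem P a) q) :
    Forces p (.coveredBy (checkId P a) (checkElem P a) X) := by
  refine forces_coveredBy.2 ⟨fun x y z q _ hy hz => ?_, fun y q hq hy => ?_⟩
  · exact (forcesMem_opair_checkId.1 hy).1.symm.trans (forcesMem_opair_checkId.1 hz).1
  · have hmem := hX y q hq hy
    exact ⟨q, le_rfl, y, hmem, forcesMem_opair_checkId.2 ⟨.refl _ _, hmem⟩⟩

theorem forces_finite_of_forall_forcesMem_checkElem {N : ℕ} {X : PName P → Formula P} {p : P}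
    (hX : ∀ z, ∀ q ≤ p, Forces q (X z) → ForcesMem z (checkElem P N) q) :
    Forces p (.finite (checkOrd P ℕ) X) :=
  forces_exIn.2 fun q hq => ⟨q, le_rfl, checkElem P N, forcesMem_ofFamily_self _ N q,
    .ex (checkId P N) (forces_coveredBy_checkId fun z r hr => hX z r (hr.trans hq))⟩

variable {I : Type*} {t : I → PName P} {X : PName P → Formula P} {f : PName P} {p : P}

theorem exists_forall_forcesMem_opair_checkElem {k : PName P} {m : W}
    (hf : Forces p (.coveredBy f k X)) (hk : ForcesEq k (checkElem P m) p) (S : Finset I)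
    (hS : ∀ i ∈ S, Forces p (X (t i))) :
    ∃ r ≤ p, ∀ i ∈ S, ∃ j < m, ForcesMem (opair (checkElem P j) (t i)) f r := by
  classical
  induction S using Finset.induction_on with
  | empty => exact ⟨p, le_rfl, by simp⟩
  | insert i S _ ih =>
    rw [Finset.forall_mem_insert] at hS
    obtain ⟨r, hr, hval⟩ := ih hS.2
    obtain ⟨q, hq, y, hyk, hy⟩ := (forces_coveredBy.1 hf).2 (t i) r hr (hS.1.mono hr)
    obtain ⟨q', hq', j, hj, e⟩ :=
      forcesMem_checkElem.1 (hyk.congr_right (hk.mono (hq.trans hr))) q le_rfl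
    refine ⟨q', hq'.trans (hq.trans hr), (Finset.forall_mem_insert _ _ _).2 ⟨?_, fun i' hi' => ?_⟩⟩
    · exact ⟨j, hj, (hy.mono hq').opair_congr_left e⟩
    · obtain ⟨j', hj', hmem⟩ := hval i' hi'
      exact ⟨j', hj', hmem.mono (hq'.trans hq)⟩

theorem ForcedDistinct.card_le_of_forces_coveredBy (ht : ForcedDistinct t) {k : PName P} {m : ℕ}
    (hf : Forces p (.coveredBy f k X)) (hk : ForcesEq k (checkElem P m) p) (S : Finset I)
    (hS : ∀ i ∈ S, Forces p (X (t i))) : S.card ≤ m := by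
  obtain ⟨r, hr, hval⟩ := exists_forall_forcesMem_opair_checkElem hf hk S hS
  choose! g hgm hg using hval
  by_contra! hlt
  obtain ⟨i, hi, j, hj, hij, heq⟩ := Finset.exists_ne_map_eq_of_card_lt_of_maps_to
    (t := Finset.range m) (by simpa using hlt) fun i hi => Finset.mem_range.2 (hgm i hi)
  exact hij (ht ((forces_coveredBy.1 hf).1 _ _ _ r hr (hg i hi) (heq ▸ hg j hj)))

theorem ForcedDistinct.forces_not_finite (ht : ForcedDistinct t)
    (hX : ∀ q ≤ p, ∀ m : ℕ, ∃ r ≤ q, ∃ S : Finset I, m < S.card ∧ ∀ i ∈ S, Forces r (X (t i))) :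
    Forces p (.neg (.finite (checkOrd P ℕ) X)) := by
  intro q hq hfin
  obtain ⟨q₁, hq₁, k, hk, hex⟩ := forces_exIn.1 hfin q le_rfl
  obtain ⟨q₂, hq₂, m, hkm⟩ := forcesMem_ofFamily.1 hk q₁ le_rfl
  obtain ⟨q₃, hq₃, f, hf⟩ := forces_ex.1 hex q₂ hq₂
  obtain ⟨r, hr, S, hcard, hS⟩ := hX q₃ (hq₃.trans (hq₂.trans (hq₁.trans hq))) m
  exact hcard.not_ge (ht.card_le_of_forces_coveredBy (hf.mono hr) (hkm.mono (hr.trans hq₃)) S hS)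

theorem IsCCC.countable_of_pairwise_not_compatible (hccc : IsCCC P) {r : I → P}
    (hr : Pairwise fun i j => ¬ Compatible (r i) (r j)) : Countable I := by
  have hinj : Function.Injective r := fun i j hij => by
    by_contra hne
    exact hr hne ⟨r i, le_rfl, hij.le⟩
  have : Countable (Set.range r) := by
    refine (hccc _ ?_).to_subtype
    rintro _ ⟨i, rfl⟩ _ ⟨j, rfl⟩ hij
    exact hr fun h => hij (congrArg r h)
  exact (Set.rangeFactorization_injective.2 hinj).countable

theorem IsCCC.countable_setOf_forcesMem_opair (hccc : IsCCC P) (ht : ForcedDistinct t)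
    (hf : Forces p (.singleValued fun x y => .mem (opair x y) f)) (x : PName P) :
    {i | ∃ r ≤ p, ForcesMem (opair x (t i)) f r}.Countable := by
  choose r hr hmem using fun i : {i | ∃ r ≤ p, ForcesMem (opair x (t i)) f r} => i.2
  refine Set.countable_coe_iff.1 (hccc.countable_of_pairwise_not_compatible (r := r) ?_)
  rintro i j hij ⟨c, hi, hj⟩
  exact hij (Subtype.ext (ht (forces_singleValued.1 hf _ _ _ c (hi.trans (hr i))
    ((hmem i).mono hi) ((hmem j).mono hj))))

theorem IsCCC.countable_of_forces_coveredBy (hccc : IsCCC P) (ht : ForcedDistinct t)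
    (hf : Forces p (.coveredBy f (checkOrd P ℕ) X)) :
    {i | ∃ q ≤ p, Forces q (X (t i))}.Countable := by
  refine (Set.countable_iUnion fun n : ℕ =>
    hccc.countable_setOf_forcesMem_opair ht hf.1 (checkElem P n)).mono ?_
  rintro i ⟨q, hq, hX⟩
  obtain ⟨r, hr, k, hk, hmem⟩ := (forces_coveredBy.1 hf).2 _ q hq hX
  obtain ⟨r', hr', n, e⟩ := forcesMem_ofFamily.1 hk r le_rfl
  exact Set.mem_iUnion.2 ⟨n, r', hr'.trans (hr.trans hq), (hmem.mono hr').opair_congr_left e⟩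

theorem IsCCC.forces_not_countable (hccc : IsCCC P) (ht : ForcedDistinct t)
    (hX : ∀ q ≤ p, ¬ {i | ∃ r ≤ q, Forces r (X (t i))}.Countable) :
    Forces p (.neg (.countable (checkOrd P ℕ) X)) := by
  intro q hq hcount
  obtain ⟨r, hr, f, hf⟩ := forces_ex.1 hcount q le_rfl
  exact hX r (hr.trans hq) (hccc.countable_of_forces_coveredBy ht hf)

end Cardinality

section MaximalAntichain

variable {P : Type*} [Preorder P]

theorem exists_maximal_antichain (D : Set P) :
    ∃ A ⊆ D, A.Pairwise (fun p q => ¬ Compatible p q) ∧ ∀ p ∈ D, ∃ q ∈ A, Compatible q p := by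
  obtain ⟨A, hA⟩ := zorn_subset {A | A ⊆ D ∧ A.Pairwise fun p q => ¬ Compatible p q}
    fun c hcD hc => ⟨⋃₀ c, ⟨Set.sUnion_subset fun s hs => (hcD hs).1,
      (Set.pairwise_sUnion hc.directedOn).2 fun s hs => (hcD hs).2⟩,
      fun s hs => Set.subset_sUnion_of_mem hs⟩
  refine ⟨A, hA.prop.1, hA.prop.2, fun p hp => ?_⟩
  by_contra! hno
  have hins : A ⊆ D ∧ A.Pairwise (fun p q => ¬ Compatible p q) := hA.prop
  have hpA : p ∈ A := by
    refine hA.le_of_ge ⟨Set.insert_subset hp hins.1, Set.pairwise_insert.2 ⟨hins.2, ?_⟩⟩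
      (Set.subset_insert _ _) (Set.mem_insert _ _)
    exact fun q hq _ => ⟨fun ⟨r, hrp, hrq⟩ => hno q hq ⟨r, hrq, hrp⟩, hno q hq⟩
  exact hno p hpA ⟨p, le_rfl, le_rfl⟩

theorem IsCCC.exists_forall_le_not_countable (hccc : IsCCC P) {W : Type*} {G : P → Set W}
    (hG : Antitone G) (hun : ¬ (⋃ p, G p).Countable) :
    ∃ q, ∀ p ≤ q, ¬ {a | ∃ r ≤ p, a ∈ G r}.Countable := by
  by_contra! hdense
  obtain ⟨A, hAD, hA, hmax⟩ := exists_maximal_antichain {p | {a | ∃ r ≤ p, a ∈ G r}.Countable}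
  have hAc : A.Countable := hccc A fun p hp q hq => hA hp hq
  refine hun ((hAc.biUnion hAD).mono (Set.iUnion_subset fun p a hap => ?_))
  obtain ⟨q, hqp, hq⟩ := hdense p
  obtain ⟨p', hp', r, hr, hrq⟩ := hmax q hq
  exact Set.mem_biUnion hp' ⟨r, hr, hG (hrq.trans hqp) hap⟩

end MaximalAntichain

/-! ### Uncountable sets -/

section Uncountable

variable {I : Type*} {S T : Set I}

theorem nonempty_of_not_countable (hS : ¬ S.Countable) : S.Nonempty :=
  Set.Infinite.nonempty (mt Set.Finite.countable hS)

theorem not_countable_inter_of_countable_compl (hS : ¬ S.Countable) (hT : Tᶜ.Countable) :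
    ¬ (S ∩ T).Countable := fun h =>
  hS ((h.union hT).mono fun i hi => (em (i ∈ T)).imp (fun h => ⟨hi, h⟩) id)

theorem exists_not_countable_fiber {C : Type*} [Countable C] (hS : ¬ S.Countable) (f : I → C) :
    ∃ c, ¬ {i ∈ S | f i = c}.Countable := by
  by_contra! hfiber
  refine hS ((Set.countable_iUnion hfiber).mono fun i hi => ?_)
  exact Set.mem_iUnion.2 ⟨f i, hi, rfl⟩

theorem countable_compl_setOf_forall_not_countable_fiber {C : ℕ → Type*} [∀ m, Countable (C m)]
    (τ : ∀ m, I → C m) : {i | ∀ m, ¬ (τ m ⁻¹' {τ m i}).Countable}ᶜ.Countable := by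
  refine (Set.countable_iUnion fun m => Set.countable_iUnion
    fun c : {c // (τ m ⁻¹' {c}).Countable} => c.2).mono fun i hi => ?_
  simp only [Set.mem_compl_iff, Set.mem_ofPred_eq, not_forall, not_not] at hi
  obtain ⟨m, hm⟩ := hi
  exact Set.mem_iUnion₂.2 ⟨m, ⟨τ m i, hm⟩, rfl⟩

theorem exists_not_countable_root {W : Type*} (hS : ¬ S.Countable) (G : I → Finset W) :
    ∃ R : Finset W, ∃ T ⊆ S, ¬ T.Countable ∧ (∀ i ∈ T, R ⊆ G i) ∧
      ∀ a ∉ R, {i ∈ T | a ∈ G i}.Countable := by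
  classical
  obtain ⟨k, hk⟩ := exists_not_countable_fiber hS fun i => (G i).card
  let roots : Set (Finset W) := {R | ¬ {i ∈ {i ∈ S | (G i).card = k} | R ⊆ G i}.Countable}
  have hbdd : BddAbove (Finset.card '' roots) := by
    refine ⟨k, ?_⟩
    rintro _ ⟨R, hR, rfl⟩
    obtain ⟨i, ⟨-, rfl⟩, hRi⟩ := nonempty_of_not_countable hR
    exact Finset.card_le_card hRi
  have hne : roots.Nonempty := ⟨∅, by simpa [roots] using hk⟩
  obtain ⟨_, ⟨R, hR, rfl⟩, hmax⟩ := hbdd.exists_isGreatest_of_nonempty (hne.image _)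
  refine ⟨R, {i ∈ {i ∈ S | (G i).card = k} | R ⊆ G i}, fun i hi => hi.1.1, hR,
    fun i hi => hi.2, fun a ha => ?_⟩
  by_contra hun
  have hinsert : insert a R ∈ roots := fun hc => by
    refine hun (hc.mono ?_)
    rintro i ⟨⟨hi, hRi⟩, hai⟩
    exact ⟨hi, Finset.insert_subset hai hRi⟩
  have hle : (insert a R).card ≤ R.card := hmax ⟨_, hinsert, rfl⟩
  rw [Finset.card_insert_of_notMem ha] at hle
  omega

end Uncountable

theorem Omega1.countable_Iic (a : Omega1) : (Set.Iic a).Countable := by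
  have hlt : Ordinal.typein (α := Omega1) (· < ·) a < (Cardinal.aleph 1).ord :=
    (Ordinal.typein_lt_self a).trans_eq (Cardinal.ord_aleph 1).symm
  rw [Cardinal.lt_ord, Ordinal.card_typein, ← Cardinal.succ_aleph0, Order.lt_succ_iff] at hlt
  rw [← Set.Iio_insert]
  exact (Cardinal.le_aleph0_iff_set_countable.1 hlt).insert a

instance Omega1.instUncountable : Uncountable Omega1 := by
  rw [← Cardinal.aleph0_lt_mk_iff, Cardinal.mk_toType, ← Cardinal.ord_aleph, Cardinal.card_ord]
  exact Cardinal.aleph0_lt_aleph_one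

instance uncountable_nat_arrow_bool : Uncountable (ℕ → Bool) := by
  rw [← Cardinal.aleph0_lt_mk_iff]
  simpa using Cardinal.cantor Cardinal.aleph0

/-! ### Disagreement and almost inclusion of partial functions -/

section PartialFunctions

variable {X V : Type*}

/-- The points at which two partial functions take different values. Coherence of a family says
that this set is finite for any two members. -/
def disagreement (f g : X →. V) : Set X :=
  {k | ∃ u ∈ f k, ∃ v ∈ g k, u ≠ v}

/-- Inclusion of graphs modulo finitely many points, `f ⊆* g`. -/
def AlmostSubset (f g : X →. V) : Prop :=
  {k | ∃ u ∈ f k, u ∉ g k}.Finite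

/-- The intersection of the graphs of the members of `F`. For `F = ∅`, where the intersection is
not a function, the values are arbitrary. -/
noncomputable def commonPart (F : Set (X →. V)) : X →. V :=
  fun k => ⟨∃ u, ∀ f ∈ F, u ∈ f k, Exists.choose⟩

theorem disagreement_self (f : X →. V) : disagreement f f = ∅ :=
  Set.eq_empty_of_forall_notMem fun _ ⟨_, hu, _, hv, hne⟩ => hne (Part.mem_unique hu hv)

theorem disagreement_comm (f g : X →. V) : disagreement f g = disagreement g f :=
  Set.ext fun _ => ⟨fun ⟨u, hu, v, hv, hne⟩ => ⟨v, hv, u, hu, hne.symm⟩,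
    fun ⟨u, hu, v, hv, hne⟩ => ⟨v, hv, u, hu, hne.symm⟩⟩

theorem AlmostSubset.refl (f : X →. V) : AlmostSubset f f := by
  simp [AlmostSubset]

theorem mem_of_mem_commonPart {F : Set (X →. V)} {k : X} {u : V} (hu : u ∈ commonPart F k)
    {f : X →. V} (hf : f ∈ F) : u ∈ f k := by
  obtain ⟨hdom, rfl⟩ := hu
  exact hdom.choose_spec f hf

theorem mem_commonPart {F : Set (X →. V)} (hF : F.Nonempty) {k : X} {u : V}
    (hu : ∀ f ∈ F, u ∈ f k) : u ∈ commonPart F k := by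
  obtain ⟨f, hf⟩ := hF
  have hdom : ∃ v, ∀ f ∈ F, v ∈ f k := ⟨u, hu⟩
  exact ⟨hdom, Part.mem_unique (hdom.choose_spec f hf) (hu f hf)⟩

theorem AlmostSubset.commonPart {g : X →. V} {F : Set (X →. V)} (hF : F.Finite)
    (hne : F.Nonempty) (hg : ∀ f ∈ F, AlmostSubset g f) : AlmostSubset g (commonPart F) := by
  refine (hF.biUnion hg).subset ?_
  rintro k ⟨u, hu, hnot⟩
  by_contra hk
  refine hnot (mem_commonPart hne fun f hf => ?_)
  by_contra huf
  exact hk (Set.mem_biUnion hf ⟨u, hu, huf⟩)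

theorem disagreement_commonPart_subset {F G : Set (X →. V)} {f g : X →. V} (hf : f ∈ F)
    (hg : g ∈ G) : disagreement (commonPart F) (commonPart G) ⊆ disagreement f g :=
  fun _ ⟨u, hu, v, hv, hne⟩ =>
    ⟨u, mem_of_mem_commonPart hu hf, v, mem_of_mem_commonPart hv hg, hne⟩

theorem exists_total_of_disagreement_subset [Nonempty V] {F G : Set (X →. V)} {D : Set X}
    (hD : ∀ f ∈ F, ∀ g ∈ G, disagreement f g ⊆ D) :
    ∃ t : X → V, ∀ f ∈ F, ∀ g ∈ G, ∀ k ∉ D, ∀ u ∈ f k, u ∈ g k → t k = u := by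
  have hvalue : ∀ k, ∃ v, ∀ f ∈ F, ∀ g ∈ G, k ∉ D → ∀ u ∈ f k, u ∈ g k → v = u := by
    intro k
    by_cases hex : ∃ f ∈ F, ∃ g ∈ G, ∃ v ∈ f k, v ∈ g k
    · obtain ⟨f, hf, _, _, v, hvf, _⟩ := hex
      refine ⟨v, fun _ _ g hg hk u _ hug => ?_⟩
      by_contra hne
      exact hk (hD f hf g hg ⟨v, hvf, u, hug, hne⟩)
    · exact ⟨Classical.arbitrary V, fun f hf g hg _ u huf hug =>
        absurd ⟨f, hf, g, hg, u, huf, hug⟩ hex⟩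
  choose t ht using hvalue
  exact ⟨t, fun f hf g hg k => ht k f hf g hg⟩

theorem AlmostSubset.of_eq_on_common {p f g : X →. V} {t : X → V} {D : Set X} (hD : D.Finite)
    (ht : ∀ k ∉ D, ∀ u ∈ f k, u ∈ g k → t k = u) (hf : AlmostSubset p f)
    (hg : AlmostSubset p g) : AlmostSubset p t := by
  refine ((hD.union hf).union hg).subset ?_
  rintro k ⟨u, hu, hnot⟩
  by_contra hk
  simp only [Set.mem_union, Set.mem_ofPred_eq, not_or, not_exists, not_and, not_not] at hk
  obtain ⟨⟨hkD, hkf⟩, hkg⟩ := hk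
  exact hnot (by simp [ht k hkD u (hkf u hu) (hkg u hu)])

/- Take two condensation points of the family whose disagreement is as large as possible: sequences
that agree with them on this finite set can disagree nowhere else. -/
theorem exists_not_countable_disagreement_eq [Countable V] {I : Type*} [Uncountable I]
    (f : I → ℕ →. V) {N : ℕ} (hN : ∀ i j, (disagreement (f i) (f j)).encard ≤ N) :
    ∃ D : Set ℕ, D.Finite ∧ ∃ U W : Set I, ¬ U.Countable ∧ ¬ W.Countable ∧
      ∀ i ∈ U, ∀ j ∈ W, disagreement (f i) (f j) = D := by
  have : Countable (Part V) := by
    classical exact Part.equivOption.injective.countable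
  have hfin : ∀ i j, (disagreement (f i) (f j)).Finite := fun i j =>
    Set.finite_of_encard_le_coe (hN i j)
  let τ (m : ℕ) (i : I) (k : Fin m) : Part V := f i k
  let Y : Set I := {i | ∀ m, ¬ (τ m ⁻¹' {τ m i}).Countable}
  have hY : Yᶜ.Countable := countable_compl_setOf_forall_not_countable_fiber τ
  have hYne : Y.Nonempty := nonempty_of_not_countable fun hc =>
    Set.not_countable_univ (by simpa using hc.union hY)
  let size (p : I × I) : ℕ := (disagreement (f p.1) (f p.2)).ncard
  have hbdd : BddAbove (size '' Y ×ˢ Y) := by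
    refine ⟨N, ?_⟩
    rintro _ ⟨p, -, rfl⟩
    exact_mod_cast (hfin p.1 p.2).cast_ncard_eq.trans_le (hN p.1 p.2)
  obtain ⟨_, ⟨⟨ξ, η⟩, ⟨hξ, hη⟩, rfl⟩, hmax⟩ :=
    hbdd.exists_isGreatest_of_nonempty ((hYne.prod hYne).image size)
  obtain ⟨m, hm⟩ := (hfin ξ η).bddAbove
  refine ⟨disagreement (f ξ) (f η), hfin ξ η, τ (m + 1) ⁻¹' {τ (m + 1) ξ} ∩ Y,
    τ (m + 1) ⁻¹' {τ (m + 1) η} ∩ Y, not_countable_inter_of_countable_compl (hξ _) hY,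
    not_countable_inter_of_countable_compl (hη _) hY, fun i hi j hj => ?_⟩
  have hsub : disagreement (f ξ) (f η) ⊆ disagreement (f i) (f j) := by
    intro k hk
    have hkm : k < m + 1 := Nat.lt_succ_of_le (hm hk)
    have hik : f i k = f ξ k := congrFun hi.1 ⟨k, hkm⟩
    have hjk : f j k = f η k := congrFun hj.1 ⟨k, hkm⟩
    simpa only [disagreement, Set.mem_ofPred_eq, hik, hjk] using hk
  exact (Set.eq_of_subset_of_ncard_le hsub (hmax ⟨(i, j), ⟨hi.2, hj.2⟩, rfl⟩) (hfin i j)).symm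

variable {W I : Type*} [LinearOrder W] [Countable V] [Nonempty V] [Uncountable I] {h : W → ℕ →. V}

theorem exists_total_almostSubset_of_encard_disagreement_le {a : I → W}
    (ha : ∀ δ, {i | a i ≤ δ}.Countable) {f : I → ℕ →. V}
    (hf : ∀ i, ∀ α ≤ a i, AlmostSubset (h α) (f i)) {N : ℕ}
    (hN : ∀ i j, (disagreement (f i) (f j)).encard ≤ N) :
    ∃ t : ℕ → V, ∀ α, AlmostSubset (h α) t := by
  obtain ⟨D, hDfin, U, W, hU, hW, hD⟩ := exists_not_countable_disagreement_eq f hN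
  obtain ⟨t, ht⟩ := exists_total_of_disagreement_subset (F := f '' U) (G := f '' W) (D := D) (by
    rintro _ ⟨i, hi, rfl⟩ _ ⟨j, hj, rfl⟩
    exact (hD i hi j hj).subset)
  have hunbounded : ∀ S : Set I, ¬ S.Countable → ∀ α, ∃ i ∈ S, α ≤ a i := by
    intro S hS α
    by_contra! hlt
    exact hS ((ha α).mono fun i hi => (hlt i hi).le)
  refine ⟨t, fun α => ?_⟩
  obtain ⟨i, hi, hαi⟩ := hunbounded U hU α
  obtain ⟨j, hj, hαj⟩ := hunbounded W hW α
  exact .of_eq_on_common hDfin (ht _ (Set.mem_image_of_mem f hi) _ (Set.mem_image_of_mem f hj))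
    (hf i α hαi) (hf j α hαj)

theorem exists_lt_encard_iInter_disagreement
    (hmono : ∀ ⦃α β⦄, α ≤ β → AlmostSubset (h α) (h β))
    (hext : ¬ ∃ t : ℕ → V, ∀ α, AlmostSubset (h α) t) {G : I → Finset W}
    (hne : ∀ i, (G i).Nonempty) (hG : ∀ δ, {i | ∃ α ∈ G i, α ≤ δ}.Countable) (N : ℕ) :
    ∃ i j, i ≠ j ∧ N < (⋂ α ∈ G i, ⋂ β ∈ G j, disagreement (h α) (h β)).encard := by
  let f (i : I) : ℕ →. V := commonPart (h '' (↑(G i) : Set W))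
  have hf : ∀ i, ∀ α ≤ (G i).min' (hne i), AlmostSubset (h α) (f i) := by
    refine fun i α hα => .commonPart ((G i).finite_toSet.image h) ((hne i).to_set.image h) ?_
    rintro _ ⟨β, hβ, rfl⟩
    exact hmono (hα.trans ((G i).min'_le β hβ))
  have hmin : ∀ δ, {i | (G i).min' (hne i) ≤ δ}.Countable := by
    refine fun δ => (hG δ).mono fun i hi => ?_
    exact ⟨_, (G i).min'_mem (hne i), hi⟩
  obtain ⟨i, j, hij⟩ : ∃ i j, N < (disagreement (f i) (f j)).encard := by
    by_contra! hN
    exact hext (exists_total_almostSubset_of_encard_disagreement_le hmin hf hN)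
  refine ⟨i, j, ?_, hij.trans_le (Set.encard_le_encard ?_)⟩
  · rintro rfl
    simp [disagreement_self] at hij
  · exact Set.subset_iInter₂ fun α hα => Set.subset_iInter₂ fun β hβ =>
      disagreement_commonPart_subset (Set.mem_image_of_mem h hα) (Set.mem_image_of_mem h hβ)

end PartialFunctions

theorem Coherent.union_singleton {H : Set (ℕ →. ℕ)} (hH : Coherent H) {g : ℕ →. ℕ}
    (hg : ∀ f ∈ H, AlmostSubset f g) : Coherent (H ∪ {g}) := by
  have hfin : ∀ f ∈ H, (disagreement f g).Finite := fun f hf => (hg f hf).subset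
    fun _ ⟨u, hu, _, hv, hne⟩ => ⟨u, hu, fun hug => hne (Part.mem_unique hug hv)⟩
  intro f hf f' hf'
  change (disagreement f f').Finite
  rcases hf with hf | hf <;> rcases hf' with hf' | hf'
  · exact hH f hf f' hf'
  · exact Set.mem_singleton_iff.1 hf' ▸ hfin f hf
  · exact disagreement_comm f f' ▸ Set.mem_singleton_iff.1 hf ▸ hfin f' hf'
  · rw [Set.mem_singleton_iff.1 hf, Set.mem_singleton_iff.1 hf', disagreement_self]
    exact Set.finite_empty

theorem Coherent.almostSubset {h : Omega1 → (ℕ →. ℕ)} (hcoh : Coherent (Set.range h))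
    (hdom : ModFiniteIncreasingDoms h) {α β : Omega1} (hαβ : α ≤ β) :
    AlmostSubset (h α) (h β) := by
  rcases hαβ.eq_or_lt with rfl | hlt
  · exact .refl _
  refine ((hdom α β hlt).union (hcoh _ ⟨α, rfl⟩ _ ⟨β, rfl⟩)).subset ?_
  rintro k ⟨u, hu, hnot⟩
  by_cases hk : k ∈ (h β).Dom
  · obtain ⟨v, hv⟩ := (PFun.mem_dom _ _).1 hk
    exact .inr ⟨u, hu, v, hv, fun e => hnot (e ▸ hv)⟩
  · exact .inl ⟨(PFun.mem_dom _ _).2 ⟨u, hu⟩, hk⟩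

theorem not_isFunctionGraph_unionRestrict_iff {f g : ℕ →. ℕ} {s : Set ℕ} :
    ¬ IsFunctionGraph (unionRestrict f g s) ↔ ∃ k ∈ s, k ∈ disagreement f g := by
  constructor
  · intro hgraph
    by_contra! hs
    refine hgraph ?_
    rintro n x y ⟨hn, hx⟩ ⟨-, hy⟩
    have hagree : ∀ u ∈ f n, ∀ v ∈ g n, u = v := by
      by_contra! hne
      exact hs n hn hne
    rcases hx with hx | hx <;> rcases hy with hy | hy
    exacts [Part.mem_unique hx hy, hagree x hx y hy, (hagree y hy x hx).symm,
      Part.mem_unique hx hy]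
  · rintro ⟨k, hk, u, hu, v, hv, hne⟩ hgraph
    exact hne (hgraph k u v ⟨hk, .inl hu⟩ ⟨hk, .inr hv⟩)

/-! ### Extending conditions -/

theorem exists_injOn_length {n m : ℕ} {D : Set ℕ} (hD : ((m + 2 ^ n : ℕ) : ℕ∞) ≤ D.encard) :
    ∃ e : List Bool → ℕ, (∀ ρ, ρ.length = n → e ρ ∈ D ∧ m ≤ e ρ) ∧
      Set.InjOn e {ρ | ρ.length = n} := by
  have hcard : {ρ : List Bool | ρ.length = n}.encard = ((2 ^ n : ℕ) : ℕ∞) := by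
    change ENat.card (List.Vector Bool n) = _
    rw [ENat.card_eq_coe_fintype_card, card_vector, Fintype.card_bool]
  have hle : ((2 ^ n : ℕ) : ℕ∞) ≤ (D \ Set.Iio m).encard := by
    have hm : (Set.Iio m).encard = m := by
      rw [← Finset.coe_Iio, Set.encard_coe_eq_coe_finsetCard, Nat.card_Iio]
    refine le_trans ?_ (Set.tsub_encard_le_encard_sdiff D (Set.Iio m))
    rw [hm]
    exact ENat.le_sub_of_add_le_left (ENat.natCast_ne_top m) (by exact_mod_cast hD)
  obtain ⟨e, he, hinj⟩ := (List.finite_length_eq Bool n).exists_injOn_of_encard_le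
    (hcard.trans_le hle)
  exact ⟨e, fun ρ hρ => ⟨(he hρ).1, not_lt.1 (he hρ).2⟩, hinj⟩

namespace QPoset

variable {h : Omega1 → (ℕ →. ℕ)} (r : QPoset h)

theorem exists_mem_disagreement {α β : Omega1} (hα : α ∈ r.Γ) (hβ : β ∈ r.Γ) (hne : α ≠ β)
    {ρ : List Bool} (hρ : ρ.length = r.n) : ∃ k ∈ r.s ρ, k ∈ disagreement (h α) (h β) :=
  not_isFunctionGraph_unionRestrict_iff.1 (r.not_function α hα β hβ hne ρ hρ)

theorem finite_setOf_mem_s : {x : List Bool × ℕ | x.2 ∈ r.s x.1}.Finite := by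
  refine ((List.finite_length_le Bool r.n).biUnion fun σ _ =>
    (Set.finite_singleton σ).prod (r.s σ).finite_toSet).subset ?_
  rintro ⟨σ, k⟩ hk
  refine Set.mem_biUnion (x := σ) ?_ ⟨rfl, hk⟩
  by_contra hσ
  have hempty : r.s σ = ∅ := r.s_out σ (not_le.1 hσ)
  simp [hempty] at hk

theorem exists_bound : ∃ m, ∀ σ, ∀ k ∈ r.s σ, k < m := by
  obtain ⟨m, hm⟩ := (r.finite_setOf_mem_s.image Prod.snd).bddAbove
  exact ⟨m + 1, fun σ k hk => Nat.lt_succ_of_le (hm ⟨(σ, k), hk, rfl⟩)⟩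

theorem countable_range_s : (Set.range (QPoset.s : QPoset h → List Bool → Finset ℕ)).Countable := by
  refine Set.MapsTo.countable_of_injOn (f := fun s => {x : List Bool × ℕ | x.2 ∈ s x.1}) ?_ ?_
    Set.Countable.ofPred_finite
  · rintro _ ⟨r, rfl⟩
    exact r.finite_setOf_mem_s
  · intro s _ s' _ heq
    ext σ k
    exact Set.ext_iff.1 heq (σ, k)

/-- The system which extends `s`, indexed by the sequences of length at most `n`, to the sequences
of length `n + 1`, by adding a point `e ρ` to `s (ρ ↾ n)`. -/
def extendSystem (s : List Bool → Finset ℕ) (n : ℕ) (e : List Bool → ℕ) (ρ : List Bool) :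
    Finset ℕ :=
  if ρ.length = n + 1 then insert (e ρ) (s (ρ.take n)) else s ρ

section extendSystem

variable {s : List Bool → Finset ℕ} {n : ℕ} {e : List Bool → ℕ} {ρ : List Bool}

theorem extendSystem_of_length_eq (hρ : ρ.length = n + 1) :
    extendSystem s n e ρ = insert (e ρ) (s (ρ.take n)) :=
  if_pos hρ

theorem extendSystem_of_length_ne (hρ : ρ.length ≠ n + 1) : extendSystem s n e ρ = s ρ :=
  if_neg hρ

theorem extendSystem_take {j : ℕ} (hj : j ≤ n) :
    extendSystem s n e (ρ.take j) = s ((ρ.take n).take j) := by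
  have hlen : (ρ.take j).length ≤ j := List.length_take_le _ _
  rw [List.take_take, min_eq_left hj, extendSystem_of_length_ne (by omega)]

end extendSystem

variable {r} {e : List Bool → ℕ} {ρ ψ : List Bool}

theorem extendSystem_take_subset (hρ : ρ.length = r.n + 1) {j k : ℕ} (hjk : j ≤ k)
    (hk : k ≤ r.n + 1) :
    extendSystem r.s r.n e (ρ.take j) ⊆ extendSystem r.s r.n e (ρ.take k) := by
  have hlen : (ρ.take r.n).length = r.n := by simp [hρ]
  rcases hk.eq_or_lt with rfl | hk
  · rcases hjk.eq_or_lt with rfl | hj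
    · rfl
    · have hsub := r.increasing _ hlen j r.n (by omega) le_rfl
      rw [List.take_of_length_le hlen.le] at hsub
      rw [List.take_of_length_le hρ.le, extendSystem_take (by omega), extendSystem_of_length_eq hρ]
      exact hsub.trans (Finset.subset_insert _ _)
  · rw [extendSystem_take (by omega), extendSystem_take (by omega)]
    exact r.increasing _ hlen j k hjk (by omega)

theorem extendSystem_inter (hinj : Set.InjOn e {ρ | ρ.length = r.n + 1})
    (hnew : ∀ ρ, ρ.length = r.n + 1 → ∀ σ, e ρ ∉ r.s σ) (hρ : ρ.length = r.n + 1)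
    (hψ : ψ.length = r.n + 1) {j : ℕ}
    (hj : IsGreatest {i : ℕ | i ≤ r.n + 1 ∧ ρ.take i = ψ.take i} j) :
    extendSystem r.s r.n e ρ ∩ extendSystem r.s r.n e ψ = extendSystem r.s r.n e (ρ.take j) := by
  obtain ⟨⟨hjn, hjeq⟩, hmax⟩ := hj
  rcases hjn.eq_or_lt with rfl | hjn
  · rw [List.take_of_length_le hρ.le, List.take_of_length_le hψ.le] at hjeq
    rw [← hjeq, List.take_of_length_le hρ.le, Finset.inter_self]
  · rw [Nat.lt_succ_iff] at hjn
    have hne : e ρ ≠ e ψ := fun he => by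
      have hle : r.n + 1 ≤ j := hmax ⟨le_rfl, congrArg _ (hinj hρ hψ he)⟩
      omega
    have hgreatest : IsGreatest {i | i ≤ r.n ∧ (ρ.take r.n).take i = (ψ.take r.n).take i} j := by
      refine ⟨⟨hjn, by simpa [List.take_take, hjn] using hjeq⟩, ?_⟩
      rintro i ⟨hi, hieq⟩
      exact hmax ⟨by omega, by simpa [List.take_take, hi] using hieq⟩
    rw [extendSystem_take hjn, extendSystem_of_length_eq hρ, extendSystem_of_length_eq hψ,
      ← r.inter_eq _ _ (by simp [hρ]) (by simp [hψ]) j hgreatest,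
      Finset.insert_inter_of_notMem (by simpa [hne] using hnew ρ hρ _),
      Finset.inter_insert_of_notMem (hnew ψ hψ _)]

/-- The condition obtained from `r` by adding a level to its system, with a new point `e ρ` at each
node `ρ ∈ 2^{n+1}`, and replacing its side condition by `Γ'`. -/
def extend (r : QPoset h) (e : List Bool → ℕ) (Γ' : Finset Omega1)
    (hinj : Set.InjOn e {ρ | ρ.length = r.n + 1})
    (hnew : ∀ ρ, ρ.length = r.n + 1 → ∀ σ, e ρ ∉ r.s σ)
    (hΓ' : ∀ α ∈ Γ', ∀ β ∈ Γ', α ≠ β → ∀ ρ, ρ.length = r.n + 1 →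
      ∃ k ∈ insert (e ρ) (r.s (ρ.take r.n)), k ∈ disagreement (h α) (h β)) : QPoset h where
  n := r.n + 1
  s := extendSystem r.s r.n e
  Γ := Γ'
  s_out ρ hρ := by
    rw [extendSystem_of_length_ne hρ.ne']
    exact r.s_out ρ (by omega)
  not_function α hα β hβ hne ρ hρ := by
    rw [extendSystem_of_length_eq hρ]
    exact not_isFunctionGraph_unionRestrict_iff.2 (hΓ' α hα β hβ hne ρ hρ)
  increasing _ hρ _ _ := extendSystem_take_subset hρ
  inter_eq _ _ hρ hψ _ := extendSystem_inter hinj hnew hρ hψ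

theorem extend_le {Γ' : Finset Omega1} {hinj hnew hΓ'} {q : QPoset h} (hn : q.n = r.n)
    (hs : q.s = r.s) (hΓ : q.Γ ⊆ Γ') : r.extend e Γ' hinj hnew hΓ' ≤ q := by
  refine ⟨hn.le.trans r.n.le_succ, hΓ, fun ρ hρ => ?_⟩
  rw [hs]
  exact extendSystem_of_length_ne (by omega)

/-! ### The countable chain condition -/

theorem compatible_of_subset_disagreement {q r : QPoset h} (hn : q.n = r.n) (hs : q.s = r.s)
    {m : ℕ} (hm : ∀ σ, ∀ k ∈ q.s σ, k < m) {D : Set ℕ}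
    (hD : ∀ α ∈ q.Γ, α ∉ r.Γ → ∀ β ∈ r.Γ, β ∉ q.Γ → D ⊆ disagreement (h α) (h β))
    (hcard : ((m + 2 ^ (q.n + 1) : ℕ) : ℕ∞) ≤ D.encard) : Compatible q r := by
  obtain ⟨e, he, hinj⟩ := exists_injOn_length hcard
  have hnew : ∀ ρ, ρ.length = q.n + 1 → ∀ σ, e ρ ∉ q.s σ := fun ρ hρ σ hmem =>
    (hm σ _ hmem).not_ge (he ρ hρ).2
  refine ⟨q.extend e (q.Γ ∪ r.Γ) hinj hnew fun α hα β hβ hne ρ hρ => ?_,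
    extend_le rfl rfl Finset.subset_union_left, extend_le hn.symm hs.symm Finset.subset_union_right⟩
  have hlen : (ρ.take q.n).length = q.n := by simp [hρ]
  by_cases hq : α ∈ q.Γ ∧ β ∈ q.Γ
  · obtain ⟨k, hk, hdis⟩ := q.exists_mem_disagreement hq.1 hq.2 hne hlen
    exact ⟨k, Finset.mem_insert_of_mem hk, hdis⟩
  by_cases hr : α ∈ r.Γ ∧ β ∈ r.Γ
  · obtain ⟨k, hk, hdis⟩ := r.exists_mem_disagreement hr.1 hr.2 hne (hlen.trans hn)
    exact ⟨k, Finset.mem_insert_of_mem (hs ▸ hk), hdis⟩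
  refine ⟨e ρ, Finset.mem_insert_self _ _, ?_⟩
  rw [Finset.mem_union] at hα hβ
  by_cases hαq : α ∈ q.Γ
  · exact hD α hαq (by tauto) β (by tauto) (by tauto) (he ρ hρ).1
  · rw [disagreement_comm]
    exact hD β (by tauto) (by tauto) α (by tauto) hαq (he ρ hρ).1

theorem exists_not_countable_subset {A : Set (QPoset h)} (hA : ¬ A.Countable) :
    ∃ T ⊆ A, ¬ T.Countable ∧ (∀ q ∈ T, ∀ r ∈ T, q.n = r.n ∧ q.s = r.s) ∧
      ∃ R, (∀ q ∈ T, R ⊂ q.Γ) ∧ ∀ α ∉ R, {q ∈ T | α ∈ q.Γ}.Countable := by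
  have := (countable_range_s (h := h)).to_subtype
  obtain ⟨c, hS⟩ := exists_not_countable_fiber hA
    fun q => (q.n, (⟨q.s, q, rfl⟩ : Set.range (QPoset.s (h := h))))
  obtain ⟨R, T, hTS, hT, hR, hroot⟩ := exists_not_countable_root hS QPoset.Γ
  have hsystem : ∀ q ∈ T, ∀ r ∈ T, q.n = r.n ∧ q.s = r.s := fun q hq r hr => by
    have heq := (hTS hq).2.trans (hTS hr).2.symm
    exact ⟨congrArg Prod.fst heq, congrArg (fun c => c.2.1) heq⟩
  have hsub : {q ∈ T | q.Γ = R}.Subsingleton := fun q hq r hr =>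
    QPoset.ext (hsystem q hq.1 r hr.1).1 (hsystem q hq.1 r hr.1).2 (hq.2.trans hr.2.symm)
  refine ⟨T \ {q ∈ T | q.Γ = R}, fun q hq => (hTS hq.1).1,
    fun hc => hT (hc.of_sdiff hsub.countable), fun q hq r hr => hsystem q hq.1 r hr.1, R,
    fun q hq => (hR q hq.1).ssubset_of_ne fun heq => hq.2 ?_, fun α hα => (hroot α hα).mono ?_⟩
  · exact ⟨hq.1, heq.symm⟩
  · rintro q ⟨hq, hα⟩
    exact ⟨hq.1, hα⟩

theorem isCCC (hcoh : Coherent (Set.range h)) (hdom : ModFiniteIncreasingDoms h)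
    (hext : ¬ ∃ g : ℕ → ℕ, Coherent (Set.range h ∪ {(g : ℕ →. ℕ)})) : IsCCC (QPoset h) := by
  intro A hA
  by_contra hun
  obtain ⟨T, hTA, hT, hsystem, R, hR, hroot⟩ := exists_not_countable_subset hun
  have : Uncountable T := not_countable_iff.1 (mt Set.countable_coe_iff.1 hT)
  obtain ⟨q₀, hq₀⟩ := nonempty_of_not_countable hT
  obtain ⟨m, hm⟩ := q₀.exists_bound
  have hmeet : ∀ δ, {q : T | ∃ α ∈ q.1.Γ \ R, α ≤ δ}.Countable := by
    intro δ
    refine (((Omega1.countable_Iic δ).mono (Set.sep_subset _ (· ∉ R))).biUnion fun α hα =>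
      (hroot α hα.2).preimage Subtype.val_injective).mono ?_
    rintro q ⟨α, hα, hαδ⟩
    rw [Finset.mem_sdiff] at hα
    exact Set.mem_biUnion (x := α) ⟨hαδ, hα.2⟩ ⟨q.2, hα.1⟩
  obtain ⟨⟨q, hq⟩, ⟨r, hr⟩, hne, hcard⟩ := exists_lt_encard_iInter_disagreement
    (fun _ _ => hcoh.almostSubset hdom)
    (fun ⟨t, ht⟩ => hext ⟨t, hcoh.union_singleton (Set.forall_mem_range.2 ht)⟩)
    (fun q : T => Finset.sdiff_nonempty.2 (hR q q.2).not_subset) hmeet (m + 2 ^ (q₀.n + 1))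
  obtain ⟨hn, hs⟩ := hsystem q₀ hq₀ q hq
  refine hA q (hTA hq) r (hTA hr) (fun heq => hne (Subtype.ext heq))
    (compatible_of_subset_disagreement (hsystem q hq r hr).1 (hsystem q hq r hr).2 (hs ▸ hm)
      (fun α hαq hαr β hβr hβq => ?_) (hn ▸ hcard.le))
  exact (Set.iInter₂_subset α (Finset.mem_sdiff.2 ⟨hαq, mt (@(hR r hr).1 α) hαr⟩)).trans
    (Set.iInter₂_subset β (Finset.mem_sdiff.2 ⟨hβr, mt (@(hR q hq).1 β) hβq⟩))

end QPoset

/-! ### Generic sets along branches -/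

/-- The initial segment of length `n` of an infinite binary sequence. -/
def branch (x : ℕ → Bool) (n : ℕ) : List Bool := (List.range n).map x

theorem length_branch (x : ℕ → Bool) (n : ℕ) : (branch x n).length = n := by simp [branch]

theorem take_branch (x : ℕ → Bool) {j n : ℕ} (hj : j ≤ n) : (branch x n).take j = branch x j := by
  rw [branch, ← List.map_take, List.take_range, min_eq_left hj, branch]

theorem branch_eq_iff {x y : ℕ → Bool} {n : ℕ} : branch x n = branch y n ↔ ∀ i < n, x i = y i := by
  simp [branch]

namespace QPoset

variable {h : Omega1 → (ℕ →. ℕ)} {x y : ℕ → Bool}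

theorem s_branch_subset (r : QPoset h) (x : ℕ → Bool) {j : ℕ} (hj : j ≤ r.n) :
    r.s (branch x j) ⊆ r.s (branch x r.n) := by
  simpa only [take_branch x hj, take_branch x le_rfl] using
    r.increasing (branch x r.n) (length_branch x _) j r.n hj le_rfl

theorem s_branch_mono {q r : QPoset h} (hqr : q ≤ r) (x : ℕ → Bool) :
    r.s (branch x r.n) ⊆ q.s (branch x q.n) := by
  rw [← s_eq_of_le hqr _ (length_branch x _).le]
  exact q.s_branch_subset x hqr.1

theorem exists_inter_branch_eq (hxy : x ≠ y) :
    ∃ d, ∀ r : QPoset h, d < r.n →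
      r.s (branch x r.n) ∩ r.s (branch y r.n) = r.s (branch x d) := by
  classical
  have hex := Function.ne_iff.1 hxy
  refine ⟨Nat.find hex, fun r hd => ?_⟩
  have hsplit : IsGreatest {i : ℕ | i ≤ r.n ∧ (branch x r.n).take i = (branch y r.n).take i}
      (Nat.find hex) := by
    refine ⟨⟨hd.le, ?_⟩, ?_⟩
    · rw [take_branch x hd.le, take_branch y hd.le, branch_eq_iff]
      exact fun i hi => not_not.1 (Nat.find_min hex hi)
    · rintro i ⟨hi, heq⟩
      rw [take_branch x hi, take_branch y hi, branch_eq_iff] at heq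
      by_contra! hlt
      exact Nat.find_spec hex (heq _ hlt)
  simpa only [take_branch x hd.le] using
    r.inter_eq _ _ (length_branch x r.n) (length_branch y r.n) _ hsplit

theorem exists_grow (r : QPoset h) (N : ℕ) :
    ∃ q ≤ r, q.n = r.n + 1 ∧ ∀ x, ∃ k ∈ q.s (branch x q.n), N ≤ k := by
  obtain ⟨m, hm⟩ := r.exists_bound
  obtain ⟨e, he, hinj⟩ := exists_injOn_length (n := r.n + 1) (m := max m N)
    (D := Set.univ) (by simp)
  have hnew : ∀ ρ, ρ.length = r.n + 1 → ∀ σ, e ρ ∉ r.s σ := fun ρ hρ σ hmem =>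
    (hm σ _ hmem).not_ge ((le_max_left _ _).trans (he ρ hρ).2)
  refine ⟨r.extend e r.Γ hinj hnew fun α hα β hβ hne ρ hρ => ?_, extend_le rfl rfl subset_rfl,
    rfl, fun x => ⟨e (branch x (r.n + 1)), ?_, ?_⟩⟩
  · obtain ⟨k, hk, hdis⟩ :=
      r.exists_mem_disagreement hα hβ hne (show (ρ.take r.n).length = r.n by simp [hρ])
    exact ⟨k, Finset.mem_insert_of_mem hk, hdis⟩
  · change _ ∈ extendSystem r.s r.n e (branch x (r.n + 1))
    rw [extendSystem_of_length_eq (length_branch x _)]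
    exact Finset.mem_insert_self _ _
  · exact (le_max_right _ _).trans (he _ (length_branch x _)).2

theorem exists_le_n (r : QPoset h) (m : ℕ) : ∃ q ≤ r, m ≤ q.n := by
  induction m with
  | zero => exact ⟨r, le_rfl, Nat.zero_le _⟩
  | succ m ih =>
    obtain ⟨q, hq, hm⟩ := ih
    obtain ⟨q', hq', hn, -⟩ := q.exists_grow 0
    exact ⟨q', hq'.trans hq, by omega⟩

theorem exists_le_card (r : QPoset h) (x : ℕ → Bool) (m : ℕ) :
    ∃ q ≤ r, m ≤ (q.s (branch x q.n)).card := by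
  induction m with
  | zero => exact ⟨r, le_rfl, Nat.zero_le _⟩
  | succ m ih =>
    obtain ⟨q, hq, hm⟩ := ih
    obtain ⟨N, hN⟩ := q.exists_bound
    obtain ⟨q', hq', -, hgrow⟩ := q.exists_grow N
    obtain ⟨k, hk, hNk⟩ := hgrow x
    refine ⟨q', hq'.trans hq, hm.trans_lt (Finset.card_lt_card ?_)⟩
    exact (s_branch_mono hq' x).ssubset_of_ne fun heq => (hN _ k (heq ▸ hk)).not_ge hNk

/-- The condition with `n = 0` and `Γ = {α}`, through which every `α` gets a chance to enter the
generic set `Γ`. -/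
def single (h : Omega1 → (ℕ →. ℕ)) (α : Omega1) : QPoset h where
  n := 0
  s _ := ∅
  Γ := {α}
  s_out _ _ := rfl
  not_function _ hβ _ hγ hne :=
    absurd ((Finset.mem_singleton.1 hβ).trans (Finset.mem_singleton.1 hγ).symm) hne
  increasing _ _ _ _ _ _ := subset_rfl
  inter_eq _ _ _ _ _ _ := Finset.inter_self _

/-- The name for the union of the sets `Γ` of the conditions in the generic filter. -/
noncomputable def genericΓ (h : Omega1 → (ℕ →. ℕ)) : PName (QPoset h) :=
  PName.mk {t : Omega1 × QPoset h // t.1 ∈ t.2.Γ} (fun t => checkElem _ t.1.1) fun t => t.1.2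

/-- The name for the union of the sets `s (x ↾ n)` of the conditions in the generic filter. -/
noncomputable def genericBranch (h : Omega1 → (ℕ →. ℕ)) (x : ℕ → Bool) : PName (QPoset h) :=
  PName.mk {t : ℕ × QPoset h // t.1 ∈ t.2.s (branch x t.2.n)} (fun t => checkElem _ t.1.1)
    fun t => t.1.2

/-- The name for the family of the generic sets along the branches of the ground model. -/
noncomputable def genericFamily (h : Omega1 → (ℕ →. ℕ)) : PName (QPoset h) :=
  PName.ofFamily (genericBranch h)

variable {z a b α β : PName (QPoset h)} {p : QPoset h}

theorem forcesMem_genericΓ :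
    ForcesMem z (genericΓ h) p ↔ ∀ q ≤ p, ∃ r ≤ q, ∃ α ∈ r.Γ, ForcesEq z (checkElem _ α) r := by
  refine forall_congr' fun q => forall_congr' fun _ => ⟨?_, ?_⟩
  · rintro ⟨r, hr, ⟨⟨α, r'⟩, hα⟩, hr', e⟩
    exact ⟨r, hr, α, hr'.2.1 hα, e⟩
  · rintro ⟨r, hr, α, hα, e⟩
    exact ⟨r, hr, ⟨(α, r), hα⟩, le_rfl, e⟩

theorem forcesMem_genericBranch :
    ForcesMem z (genericBranch h x) p ↔
      ∀ q ≤ p, ∃ r ≤ q, ∃ k ∈ r.s (branch x r.n), ForcesEq z (checkElem _ k) r := by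
  refine forall_congr' fun q => forall_congr' fun _ => ⟨?_, ?_⟩
  · rintro ⟨r, hr, ⟨⟨k, r'⟩, hk⟩, hr', e⟩
    exact ⟨r, hr, k, s_branch_mono hr' x hk, e⟩
  · rintro ⟨r, hr, k, hk, e⟩
    exact ⟨r, hr, ⟨(k, r), hk⟩, le_rfl, e⟩

theorem forcesMem_genericBranch_of_mem {k : ℕ} (hk : k ∈ p.s (branch x p.n)) :
    ForcesMem (checkElem _ k) (genericBranch h x) p :=
  forcesMem_genericBranch.2 fun q hq => ⟨q, le_rfl, k, s_branch_mono hq x hk, .refl _ _⟩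

theorem forcesMem_genericFamily :
    ForcesMem z (genericFamily h) p ↔ ∀ q ≤ p, ∃ r ≤ q, ∃ x, ForcesEq z (genericBranch h x) r :=
  forcesMem_ofFamily

theorem exists_forcesMem_checkElem_of_ne (hxy : x ≠ y) (p : QPoset h) :
    ∃ p' ≤ p, ∃ N : ℕ, ∀ z, ∀ q ≤ p', ForcesMem z (genericBranch h x) q →
      ForcesMem z (genericBranch h y) q → ForcesMem z (checkElem _ N) q := by
  obtain ⟨d, hd⟩ := exists_inter_branch_eq (h := h) hxy
  obtain ⟨p', hp', hdn⟩ := p.exists_le_n (d + 1)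
  obtain ⟨N, hN⟩ := p'.exists_bound
  refine ⟨p', hp', N, fun z q hq hx hy => forcesMem_checkElem.2 fun q' hq' => ?_⟩
  obtain ⟨r, hr, k, hk, e⟩ := forcesMem_genericBranch.1 hx q' hq'
  obtain ⟨r', hr', k', hk', e'⟩ := forcesMem_genericBranch.1 hy r (hr.trans hq')
  obtain rfl := forcedDistinct_checkElem ((e.mono hr').symm.trans e')
  have hrp := hr'.trans (hr.trans (hq'.trans hq))
  have hmem : k ∈ r'.s (branch x r'.n) ∩ r'.s (branch y r'.n) :=
    Finset.mem_inter.2 ⟨s_branch_mono hr' x hk, hk'⟩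
  rw [hd r' (lt_of_lt_of_le hdn hrp.1),
    s_eq_of_le hrp _ ((length_branch x d).le.trans (by omega))] at hmem
  exact ⟨r', hr'.trans hr, k, hN _ _ hmem, e'⟩

theorem forcedDistinct_genericBranch : ForcedDistinct (genericBranch h) := by
  intro x y p e
  by_contra hxy
  obtain ⟨p', hp', N, hN⟩ := exists_forcesMem_checkElem_of_ne hxy p
  obtain ⟨q, hq, -, hgrow⟩ := p'.exists_grow N
  obtain ⟨k, hk, hNk⟩ := hgrow x
  have hx := forcesMem_genericBranch_of_mem hk
  exact hNk.not_gt
    (lt_of_forcesMem_checkElem (hN _ q hq hx (hx.congr_right (e.mono (hq.trans hp')))))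

theorem forces_subset_genericΓ (p : QPoset h) :
    Forces p (.subset (genericΓ h) (checkOrd _ Omega1)) := by
  refine forces_allIn.2 fun z q _ hz => forcesMem_ofFamily.2 fun q' hq' => ?_
  obtain ⟨r, hr, α, -, e⟩ := forcesMem_genericΓ.1 hz q' hq'
  exact ⟨r, hr, α, e⟩

theorem forces_not_countable_genericΓ (hccc : IsCCC (QPoset h))
    (hp : ∀ q ≤ p, ¬ {α | ∃ r ≤ q, α ∈ r.Γ}.Countable) :
    Forces p (.neg (.countable (checkOrd _ ℕ) fun α => .mem α (genericΓ h))) := by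
  refine hccc.forces_not_countable forcedDistinct_checkElem fun q hq => mt (.mono ?_) (hp q hq)
  rintro α ⟨r, hr, hα⟩
  exact ⟨r, hr, forcesMem_genericΓ.2 fun t ht => ⟨t, le_rfl, α, ht.2.1 hα, .refl _ _⟩⟩

theorem forces_genericBranch_subset (ha : ForcesEq a (genericBranch h x) p) :
    Forces p (.subset a (checkOrd _ ℕ)) := by
  refine forces_allIn.2 fun z q hq hz => forcesMem_ofFamily.2 fun q' hq' => ?_
  obtain ⟨r, hr, k, -, e⟩ := forcesMem_genericBranch.1 (hz.congr_right (ha.mono hq)) q' hq'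
  exact ⟨r, hr, k, e⟩

theorem forces_genericBranch_infinite (ha : ForcesEq a (genericBranch h x) p) :
    Forces p (.neg (.finite (checkOrd _ ℕ) fun n => .mem n a)) := by
  refine forcedDistinct_checkElem.forces_not_finite (t := checkElem (QPoset h) (W := ℕ))
    fun q hq m => ?_
  obtain ⟨r, hr, hcard⟩ := q.exists_le_card x (m + 1)
  exact ⟨r, hr, _, hcard, fun n hn =>
    (forcesMem_genericBranch_of_mem hn).congr_right (ha.mono (hr.trans hq)).symm⟩

theorem forces_finite_inter (hxy : x ≠ y) (ha : ForcesEq a (genericBranch h x) p)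
    (hb : ForcesEq b (genericBranch h y) p) :
    Forces p (.finite (checkOrd _ ℕ) fun n => .and (.mem n a) (.mem n b)) := by
  refine Forces.of_dense fun q hq => ?_
  obtain ⟨r, hr, N, hN⟩ := exists_forcesMem_checkElem_of_ne hxy q
  refine ⟨r, hr, forces_finite_of_forall_forcesMem_checkElem (N := N) ?_⟩
  rintro z t ht ⟨hza, hzb⟩
  have htp := ht.trans (hr.trans hq)
  exact hN z t ht (hza.congr_right (ha.mono htp)) (hzb.congr_right (hb.mono htp))

theorem forces_almostDisjointFamily (p : QPoset h) :
    Forces p (.almostDisjointFamily (checkOrd _ ℕ) (genericFamily h)) := by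
  refine ⟨forces_allIn.2 fun a q _ ha => Forces.of_dense fun q' hq' => ?_,
    forces_allIn.2 fun a q _ ha => forces_allIn.2 fun b q₁ hq₁ hb => forces_imp.2
      fun q₂ hq₂ hne => Forces.of_dense fun q₃ hq₃ => ?_⟩
  · obtain ⟨r, hr, x, e⟩ := forcesMem_genericFamily.1 ha q' hq'
    exact ⟨r, hr, forces_genericBranch_subset e, forces_genericBranch_infinite e⟩
  · obtain ⟨r, hr, x, e⟩ := forcesMem_genericFamily.1 ha q₃ (hq₃.trans (hq₂.trans hq₁))
    obtain ⟨r', hr', y, e'⟩ := forcesMem_genericFamily.1 hb r (hr.trans (hq₃.trans hq₂))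
    refine ⟨r', hr'.trans hr, forces_finite_inter ?_ (e.mono hr') e'⟩
    rintro rfl
    exact hne r' (hr'.trans (hr.trans hq₃)) ((e.mono hr').trans e'.symm)

theorem forces_not_countable_genericFamily (hccc : IsCCC (QPoset h)) (p : QPoset h) :
    Forces p (.neg (.countable (checkOrd _ ℕ) fun a => .mem a (genericFamily h))) := by
  refine hccc.forces_not_countable forcedDistinct_genericBranch fun q _ hc => ?_
  refine Set.not_countable_univ (hc.mono fun x _ => ?_)
  exact ⟨q, le_rfl, forcesMem_ofFamily_self _ x q⟩

theorem forces_mem_inUnionRestrict {α₀ β₀ : Omega1} (hα : ForcesEq α (checkElem _ α₀) p)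
    (hβ : ForcesEq β (checkElem _ β₀) p) (ha : ForcesEq a (genericBranch h x) p) {n k : ℕ}
    (hnk : (n, k) ∈ unionRestrict (h α₀) (h β₀) (p.s (branch x p.n))) :
    Forces p (.inUnionRestrict (checkSeq _ h) α β a (checkElem _ n) (checkElem _ k)) := by
  have hgraph : ∀ {γ : PName (QPoset h)} {γ₀ : Omega1}, ForcesEq γ (checkElem _ γ₀) p →
      k ∈ h γ₀ n → ForcesMem (opair γ (opair (checkElem _ n) (checkElem _ k))) (checkSeq _ h) p :=
    fun {γ γ₀} e hk => (forcesMem_ofFamily_self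
      (fun t : {t : Omega1 × ℕ × ℕ // t.2.2 ∈ h t.1 t.2.1} => opair (checkElem (QPoset h) t.1.1)
        (opair (checkElem _ t.1.2.1) (checkElem _ t.1.2.2))) ⟨(γ₀, n, k), hk⟩ p).opair_congr_left
          e.symm
  exact ⟨(forcesMem_genericBranch_of_mem hnk.1).congr_right ha.symm,
    Forces.or (hnk.2.imp (hgraph hα) (hgraph hβ))⟩

theorem forces_luzinIncoherent (ha : ForcesEq a (genericBranch h x) p) :
    Forces p (.luzinIncoherent (checkSeq _ h) (genericΓ h) a) := by
  refine forces_allIn.2 fun α q hq hα => forces_allIn.2 fun β q₁ hq₁ hβ => forces_imp.2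
    fun q₂ hq₂ hlt q₃ hq₃ hsv => ?_
  obtain ⟨r, hr, α₀, hα₀, e⟩ := forcesMem_genericΓ.1 hα q₃ (hq₃.trans (hq₂.trans hq₁))
  obtain ⟨r', hr', β₀, hβ₀, e'⟩ := forcesMem_genericΓ.1 hβ r (hr.trans (hq₃.trans hq₂))
  have hα' := e.mono hr'
  have hr'₃ := hr'.trans hr
  have ha' := ha.mono (hr'₃.trans (hq₃.trans (hq₂.trans (hq₁.trans hq))))
  have hlt₀ : α₀ < β₀ := lt_of_forcesMem_checkElem
    (((ForcesMem.mono hlt (hr'₃.trans hq₃)).congr_left hα').congr_right e')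
  refine r'.not_function α₀ (hr'.2.1 hα₀) β₀ hβ₀ hlt₀.ne (branch x r'.n) (length_branch _ _) ?_
  intro n u v hu hv
  exact forcedDistinct_checkElem (forces_singleValued.1 hsv _ _ _ r' hr'₃
    (forces_mem_inUnionRestrict hα' e' ha' hu) (forces_mem_inUnionRestrict hα' e' ha' hv))

theorem forces_allIn_luzinIncoherent (p : QPoset h) :
    Forces p (.allIn (genericFamily h) (.luzinIncoherent (checkSeq _ h) (genericΓ h))) := by
  refine forces_allIn.2 fun a q _ ha => Forces.of_dense fun q' hq' => ?_
  obtain ⟨r, hr, x, e⟩ := forcesMem_genericFamily.1 ha q' hq'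
  exact ⟨r, hr, forces_luzinIncoherent e⟩

theorem exists_forall_le_not_countable_Γ (hccc : IsCCC (QPoset h)) :
    ∃ q : QPoset h, ∀ p ≤ q, ¬ {α | ∃ r ≤ p, α ∈ r.Γ}.Countable := by
  refine hccc.exists_forall_le_not_countable (G := fun p => (p.Γ : Set Omega1))
    (fun p q hpq => Finset.coe_subset.2 hpq.2.1) fun hc => Set.not_countable_univ (hc.mono ?_)
  exact fun α _ => Set.mem_iUnion.2 ⟨single h α, Finset.mem_singleton_self α⟩

end QPoset

theorem mainTheorem6 (h : Omega1 → (ℕ →. ℕ))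
    (hcoh : Coherent (Set.range h))
    (hdom : ModFiniteIncreasingDoms h)
    (hext : ¬ ∃ g : ℕ → ℕ, Coherent (Set.range h ∪ {(g : ℕ →. ℕ)})) :
    IsCCC (QPoset h) ∧
      ∃ q : QPoset h, Forces q (existsLuzinRestrictions (QPoset h) h) := by
  have hccc : IsCCC (QPoset h) := QPoset.isCCC hcoh hdom hext
  obtain ⟨q, hq⟩ := QPoset.exists_forall_le_not_countable_Γ hccc
  exact ⟨hccc, q, .ex (QPoset.genericΓ h) (.ex (QPoset.genericFamily h)
    ⟨⟨QPoset.forces_subset_genericΓ q, QPoset.forces_not_countable_genericΓ hccc hq⟩,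
      ⟨QPoset.forces_almostDisjointFamily q, QPoset.forces_not_countable_genericFamily hccc q⟩,
      QPoset.forces_allIn_luzinIncoherent q⟩)⟩
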